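/- Let $[n]=\{1,\dots,n\}$. An $[n]$-tree is a non-planar rooted tree, considered up to isomorphism, with $n$ leaves labelled $1,\dots,n$, a root of degree $1$ (which is not a leaf), and all other vertices, the branch points, of degree at least $3$. Let $\mathbb T_{[n]}$ be the finite set of $[n]$-trees. Fix $0\le\gamma\le\alpha\le1$. **Growth process.** The $(\alpha,\gamma)$-growth process is the Markov chain $(T_n)_{n\ge1}$ with $T_n\in\mathbb T_{[n]}$, in which $T_{n+1}$ is obtained from $T_n$ by inserting leaf $n+1$ into an edge (which is split by a new branch point carrying the new leaf) or into a branch point (as a further child), the part $x$ being chosen with probability $w_x/(n-\alpha)$, where $w_x=1-\alpha$ for a leaf edge, $w_x=\gamma$ for an internal edge (including, for $n\ge2$, the edge at the root), and $w_x=(c_x-1)\alpha-\gamma$ for a branch point with $c_x$ children. (For $n=1$ there is only one possible $T_2$, which is taken with probability $1$, also if $\alpha=1$.) **Chain.** The $(\alpha,\gamma)$-chain $(T_n(m))_{m\ge0}$ on $\mathbb T_{[n]}$, $n\ge2$, is the Markov chain with the following transitions from a tree $\mathbf t$. 1. Select a leaf $i\in[n]$ uniformly at random. Let $v$ be its parent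 and $c$ the number of children of $v$. 2. If $c=2$, put $\tilde I=\max\{i,a,b\}$, where $a$ is the smallest label, other than $i$, of a leaf descending from $v$, and $b$ is the smallest label of a leaf descending from the parent of $v$ but not from $v$ ($b=0$ if the parent of $v$ is the root). If $c>2$, let $i_1<\dots<i_c$ be the smallest leaf labels in the $c$ subtrees of $v$, and let $i=i_j$. Then $\tilde I=i_{j'}$ with probability $$\begin{cases}\dfrac{\alpha-\gamma}{(c-2)\alpha-\gamma}&\text{if } j\le2,\ j'=3,\\[2mm]\dfrac{\alpha}{(c-2)\alpha-\gamma}&\text{if } j\le2,\ 3<j'\le c,\\[2mm]\dfrac{\alpha}{(c-2)\alpha-\gamma}&\text{if } 2<j<j'\le c,\\[2mm]\dfrac{(j-2)\alpha-\gamma}{(c-2)\alpha-\gamma}&\text{if } 2<j=j'\le c,\end{cases}$$ and with probability $0$ in all other cases. If $(c-2)\alpha-\gamma=0$, which can happen only if $\gamma=\alpha$ and only at non-binary trees, put $\tilde I=i_c$; for $c=3$ this is the only possible value, and $c>3$ requires $\alpha=\gamma=0$. 3. Swap the labels $i$ and $\tilde I$, delete leaf $\tilde I$ (suppressing its parent if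 that is left with a single child), and relabel $\tilde I+1,\dots,n$ by $\tilde I,\dots,n-1$ in increasing order, to obtain an $[n-1]$-tree. 4. Insert leaf $n$ by the $(\alpha,\gamma)$-growth rule. For $n=1$ the chain is the constant chain on the one-point set $\mathbb T_{[1]}$. **Theorem.** For every $n\ge1$ and all $0\le\gamma\le\alpha\le1$, these rules define a stochastic transition matrix on $\mathbb T_{[n]}$; the law of $T_n$ is its unique invariant distribution; and $T_n(m)\to T_n$ in distribution as $m\to\infty$, for every law of the initial state $T_n(0)$. -/

import Mathlib

open MeasureTheory Filter Finset Matrix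

/-- A rooted, non-planar, multifurcating tree whose leaves carry the labels `0, …, n-1` (the
elements of `Fin n`, in the same order as the labels `1, …, n`), up to isomorphism.

A non-root vertex is recorded as the set of labels of the leaves above it (its clade).  As every
branch point has at least two children, distinct vertices have distinct clades, and a family of
nonempty sets arises from such a tree exactly if it contains all singletons (the leaves) and the
full set (the vertex adjacent to the root), and any two members are nested or disjoint.  The root
(of degree one) is not recorded.  The tree order is reverse inclusion: the parent of a clade is the
least clade that strictly contains it. For `n = 0` the family is empty. -/
@[ext]
structure LeafTree (n : ℕ) where
  clades : Finset (Finset (Fin n))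
  empty_notMem : ∅ ∉ clades
  singleton_mem : ∀ i, {i} ∈ clades
  univ_mem : 0 < n → univ ∈ clades
  laminar : ∀ C ∈ clades, ∀ D ∈ clades, Disjoint C D ∨ C ⊆ D ∨ D ⊆ C

namespace LeafTree

variable {n : ℕ}

noncomputable instance : DecidableEq (LeafTree n) := Classical.decEq _

noncomputable instance : Fintype (LeafTree n) :=
  Fintype.ofInjective LeafTree.clades fun _ _ h => LeafTree.ext h

/-- The finite set of trees carries the discrete `σ`-algebra and the discrete topology. -/
instance : MeasurableSpace (LeafTree n) := ⊤

instance : DiscreteMeasurableSpace (LeafTree n) := ⟨fun _ => trivial⟩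

instance : TopologicalSpace (LeafTree n) := ⊥

instance : DiscreteTopology (LeafTree n) := ⟨rfl⟩

/-! ### Vertices, edges, spinal bushes -/

/-- The children of the vertex `C`: the maximal clades strictly inside `C`. -/
def children (t : LeafTree n) (C : Finset (Fin n)) : Finset (Finset (Fin n)) :=
  {D ∈ t.clades | D ⊂ C ∧ ∀ E ∈ t.clades, D ⊂ E → ¬ E ⊂ C}

/-- The parent of the vertex `C`: the intersection, i.e. the least, of the clades that strictly
contain `C`.  If `C` is the vertex adjacent to the root (`C = univ`) the value is `univ`. -/
def parent (t : LeafTree n) (C : Finset (Fin n)) : Finset (Fin n) :=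
  {D ∈ t.clades | C ⊂ D}.inf id

/-- Every non-root vertex is identified with the edge that joins it to its parent; for the clade
`univ` this is the edge adjacent to the root.  The edge is a leaf edge iff the clade is a
singleton. -/
abbrev Edge (t : LeafTree n) : Type := {C : Finset (Fin n) // C ∈ t.clades}

/-- The branch points: the vertices that are neither the root nor a leaf. -/
abbrev BranchPoint (t : LeafTree n) : Type := {C : Finset (Fin n) // C ∈ t.clades ∧ 2 ≤ #C}

/-- The insertable parts of a tree are its edges and its branch points. -/
abbrev InsertablePart (t : LeafTree n) : Type := t.Edge ⊕ t.BranchPoint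

/-- The labels of the leaves in the first spinal bush on the ancestral line from leaf `i`, i.e. of
the leaves other than `i` above the parent of `i`. -/
def firstBush (t : LeafTree n) (i : Fin n) : Finset (Fin n) :=
  t.parent {i} \ {i}

/-- The labels of the leaves in the second spinal bush on the ancestral line from leaf `i`, i.e. of
the leaves above the grandparent of `i` but not above the parent of `i`.  It is empty if there is
only one spinal bush. -/
def secondBush (t : LeafTree n) (i : Fin n) : Finset (Fin n) :=
  t.parent (t.parent {i}) \ t.parent {i}

/-! ### Insertion, deletion, swapping -/

/-- The clade `C` of a tree on `Fin n`, as a set of labels in `Fin (n + 1)`. -/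
def lift (C : Finset (Fin n)) : Finset (Fin (n + 1)) := C.map Fin.castSuccEmb

lemma lift_subset {C D : Finset (Fin n)} : lift C ⊆ lift D ↔ C ⊆ D := Finset.map_subset_map

lemma disjoint_lift {C D : Finset (Fin n)} : Disjoint (lift C) (lift D) ↔ Disjoint C D :=
  Finset.disjoint_map _

lemma last_notMem_lift (C : Finset (Fin n)) : Fin.last n ∉ lift C := by
  simp [lift, Fin.castSucc_ne_last]

lemma lift_univ : insert (Fin.last n) (lift (univ : Finset (Fin n))) = univ := by
  ext x
  induction x using Fin.lastCases <;> simp [lift]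

/-- The clades after attaching the new leaf `Fin.last n`: the vertices in `up` gain the new leaf,
the vertices in `keep` stay as they are, and the new leaf is added. -/
def attach (keep up : Finset (Finset (Fin n))) : Finset (Finset (Fin (n + 1))) :=
  keep.image lift ∪ up.image (fun D => insert (Fin.last n) (lift D)) ∪ {{Fin.last n}}

lemma mem_attach {keep up : Finset (Finset (Fin n))} {X : Finset (Fin (n + 1))} :
    X ∈ attach keep up ↔ (∃ D ∈ keep, lift D = X) ∨
      (∃ D ∈ up, insert (Fin.last n) (lift D) = X) ∨ X = {Fin.last n} := by
  simp only [attach, Finset.mem_union, Finset.mem_image, Finset.mem_singleton, or_assoc]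

lemma attach_empty_notMem {keep up : Finset (Finset (Fin n))} (h : ∅ ∉ keep) :
    ∅ ∉ attach keep up := by
  rw [mem_attach]
  rintro (⟨D, hD, h0⟩ | ⟨D, hD, h0⟩ | h0)
  · exact h (by simpa [lift] using (Finset.map_eq_empty.1 h0) ▸ hD)
  · exact Finset.insert_ne_empty _ _ h0
  · exact Finset.singleton_ne_empty _ h0.symm

lemma attach_laminar {keep up : Finset (Finset (Fin n))}
    (hkk : ∀ C ∈ keep, ∀ D ∈ keep, Disjoint C D ∨ C ⊆ D ∨ D ⊆ C)
    (hku : ∀ C ∈ keep, ∀ D ∈ up, Disjoint C D ∨ C ⊆ D)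
    (huu : ∀ C ∈ up, ∀ D ∈ up, C ⊆ D ∨ D ⊆ C) :
    ∀ X ∈ attach keep up, ∀ Y ∈ attach keep up, Disjoint X Y ∨ X ⊆ Y ∨ Y ⊆ X := by
  have key : ∀ C ∈ keep, ∀ D ∈ up, Disjoint (lift C) (insert (Fin.last n) (lift D)) ∨
      lift C ⊆ insert (Fin.last n) (lift D) := by
    intro C hC D hD
    rcases hku C hC D hD with h | h
    · left
      rw [Finset.disjoint_insert_right]
      exact ⟨last_notMem_lift C, disjoint_lift.2 h⟩
    · exact Or.inr ((lift_subset.2 h).trans (Finset.subset_insert _ _))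
  intro X hX Y hY
  rw [mem_attach] at hX hY
  rcases hX with ⟨C, hC, rfl⟩ | ⟨C, hC, rfl⟩ | rfl <;>
    rcases hY with ⟨D, hD, rfl⟩ | ⟨D, hD, rfl⟩ | rfl
  · simpa only [lift_subset, disjoint_lift] using hkk C hC D hD
  · exact (key C hC D hD).imp id Or.inl
  · exact Or.inl (Finset.disjoint_singleton_right.2 (last_notMem_lift C))
  · exact (key D hD C hC).imp (fun h => h.symm) Or.inr
  · exact Or.inr ((huu C hC D hD).imp (fun h => Finset.insert_subset_insert _ (lift_subset.2 h))
      (fun h => Finset.insert_subset_insert _ (lift_subset.2 h)))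
  · exact Or.inr (Or.inr (by simp))
  · exact Or.inl (Finset.disjoint_singleton_left.2 (last_notMem_lift D))
  · exact Or.inr (Or.inl (by simp))
  · exact Or.inr (Or.inl subset_rfl)

lemma up_chain (t : LeafTree n) {C : Finset (Fin n)} (hC : C ∈ t.clades) :
    ∀ D ∈ {D ∈ t.clades | C ⊆ D}, ∀ E ∈ {D ∈ t.clades | C ⊆ D}, D ⊆ E ∨ E ⊆ D := by
  intro D hD E hE
  rw [Finset.mem_filter] at hD hE
  rcases t.laminar D hD.1 E hE.1 with h | h
  · exact absurd (Finset.disjoint_self_iff_empty C |>.1 (h.mono hD.2 hE.2) ▸ hC) t.empty_notMem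
  · exact h

/-- Insert the leaf `Fin.last n` into the edge between `C` and its parent: the edge is split by a
new vertex, whose children are `C` and the new leaf. -/
def insertEdge (t : LeafTree n) (e : t.Edge) : LeafTree (n + 1) where
  clades := attach {D ∈ t.clades | ¬ e.1 ⊂ D} {D ∈ t.clades | e.1 ⊆ D}
  empty_notMem := attach_empty_notMem fun h => t.empty_notMem (Finset.mem_filter.1 h).1
  singleton_mem i := by
    rw [mem_attach]
    induction i using Fin.lastCases with
    | last => exact Or.inr (Or.inr rfl)
    | cast i =>
      refine Or.inl ⟨{i}, Finset.mem_filter.2 ⟨t.singleton_mem i, fun h => ?_⟩, by simp [lift]⟩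
      exact t.empty_notMem (Finset.ssubset_singleton_iff.1 h ▸ e.2)
  univ_mem _ := by
    rw [mem_attach]
    rcases Nat.eq_zero_or_pos n with rfl | hn
    · exact Or.inr (Or.inr (by decide))
    · exact Or.inr (Or.inl
        ⟨univ, Finset.mem_filter.2 ⟨t.univ_mem hn, Finset.subset_univ _⟩, lift_univ⟩)
  laminar := by
    refine attach_laminar (fun C hC D hD => t.laminar C (Finset.mem_filter.1 hC).1 D
      (Finset.mem_filter.1 hD).1) (fun C hC D hD => ?_) (t.up_chain e.2)
    rw [Finset.mem_filter] at hC hD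
    rcases t.laminar C hC.1 D hD.1 with h | h | h
    · exact Or.inl h
    · exact Or.inr h
    · by_cases h' : e.1 = C
      · exact Or.inr (h' ▸ hD.2)
      · exact absurd ((hD.2.trans h).ssubset_of_ne h') hC.2

/-- Insert the leaf `Fin.last n` as a further child of the branch point `v`. -/
def insertBranchPoint (t : LeafTree n) (v : t.BranchPoint) : LeafTree (n + 1) where
  clades := attach {D ∈ t.clades | ¬ v.1 ⊆ D} {D ∈ t.clades | v.1 ⊆ D}
  empty_notMem := attach_empty_notMem fun h => t.empty_notMem (Finset.mem_filter.1 h).1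
  singleton_mem i := by
    rw [mem_attach]
    induction i using Fin.lastCases with
    | last => exact Or.inr (Or.inr rfl)
    | cast i =>
      refine Or.inl ⟨{i}, Finset.mem_filter.2 ⟨t.singleton_mem i, fun h => ?_⟩, by simp [lift]⟩
      have := (v.2.2).trans (Finset.card_le_card h)
      simp at this
  univ_mem _ := by
    rw [mem_attach]
    rcases Nat.eq_zero_or_pos n with rfl | hn
    · exact Or.inr (Or.inr (by decide))
    · exact Or.inr (Or.inl
        ⟨univ, Finset.mem_filter.2 ⟨t.univ_mem hn, Finset.subset_univ _⟩, lift_univ⟩)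
  laminar := by
    refine attach_laminar (fun C hC D hD => t.laminar C (Finset.mem_filter.1 hC).1 D
      (Finset.mem_filter.1 hD).1) (fun C hC D hD => ?_) (t.up_chain v.2.1)
    rw [Finset.mem_filter] at hC hD
    rcases t.laminar C hC.1 D hD.1 with h | h | h
    · exact Or.inl h
    · exact Or.inr h
    · exact absurd (hD.2.trans h) hC.2

/-- Insert the leaf `Fin.last n` into an insertable part. -/
def insertLeaf (t : LeafTree n) : t.InsertablePart → LeafTree (n + 1)
  | .inl e => t.insertEdge e
  | .inr v => t.insertBranchPoint v

/-- Delete the leaf `j` (contracting its parent if that is left with one child), and relabel the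
other leaves by the increasing bijection: `Fin.succAbove j` is the increasing bijection from
`Fin n` onto the labels other than `j`. -/
def delete (t : LeafTree (n + 1)) (j : Fin (n + 1)) : LeafTree n where
  clades := (t.clades.image fun C => ({i | j.succAbove i ∈ C} : Finset (Fin n))).erase ∅
  empty_notMem := by simp
  singleton_mem i := by
    refine Finset.mem_erase.2 ⟨Finset.singleton_ne_empty i, Finset.mem_image.2
      ⟨{j.succAbove i}, t.singleton_mem _, ?_⟩⟩
    ext k
    simp
  univ_mem hn := by
    have : Nonempty (Fin n) := ⟨⟨0, hn⟩⟩
    refine Finset.mem_erase.2 ⟨Finset.univ_nonempty.ne_empty, Finset.mem_image.2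
      ⟨univ, t.univ_mem n.succ_pos, ?_⟩⟩
    simp
  laminar := by
    intro X hX Y hY
    obtain ⟨C, hC, rfl⟩ := Finset.mem_image.1 (Finset.mem_erase.1 hX).2
    obtain ⟨D, hD, rfl⟩ := Finset.mem_image.1 (Finset.mem_erase.1 hY).2
    rcases t.laminar C hC D hD with h | h | h
    · left
      rw [Finset.disjoint_left]
      intro a ha hb
      exact Finset.disjoint_left.1 h (by simpa using ha) (by simpa using hb)
    · exact Or.inr (Or.inl fun a ha => by simpa using h (by simpa using ha))
    · exact Or.inr (Or.inr fun a ha => by simpa using h (by simpa using ha))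

/-- Swap the labels `i` and `j`. -/
def swap (t : LeafTree n) (i j : Fin n) : LeafTree n where
  clades := t.clades.image fun C => C.map (Equiv.swap i j).toEmbedding
  empty_notMem := by
    simpa using t.empty_notMem
  singleton_mem k := Finset.mem_image.2 ⟨{Equiv.swap i j k}, t.singleton_mem _, by simp⟩
  univ_mem hn := Finset.mem_image.2 ⟨univ, t.univ_mem hn, by simp⟩
  laminar := by
    intro X hX Y hY
    obtain ⟨C, hC, rfl⟩ := Finset.mem_image.1 hX
    obtain ⟨D, hD, rfl⟩ := Finset.mem_image.1 hY
    simpa only [Finset.disjoint_map, Finset.map_subset_map] using t.laminar C hC D hD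

/-! ### The growth rule -/

/-- The weight of an insertable part: `1 - α` for a leaf edge, `γ` for an internal edge,
`(c - 1) α - γ` for a branch point with `c` children. -/
noncomputable def weight (α γ : ℝ) (t : LeafTree n) : t.InsertablePart → ℝ
  | .inl e => if #e.1 = 1 then 1 - α else γ
  | .inr v => ((#(t.children v.1) : ℝ) - 1) * α - γ

/-- The transition probabilities of the `(α, γ)`-growth rule from trees with `n` leaves to trees
with `n + 1` leaves: part `x` is chosen with probability `w_x / (n - α)`.  For `n ≤ 1` there is a
single tree with `n + 1` leaves, which is chosen with probability `1`; for `n = 1` this is what the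
formula gives unless `α = 1`, where it reads `0 / 0`. -/
noncomputable def growthMatrix (α γ : ℝ) (n : ℕ) : Matrix (LeafTree n) (LeafTree (n + 1)) ℝ :=
  fun t s =>
    if n ≤ 1 then 1
    else ∑ x : t.InsertablePart, if t.insertLeaf x = s then t.weight α γ x / (n - α) else 0

/-- The law of the `n`-th step of the `(α, γ)`-growth process, as a vector of probabilities. -/
noncomputable def growthLaw (α γ : ℝ) : (n : ℕ) → LeafTree n → ℝ
  | 0 => fun _ => 1
  | n + 1 => growthLaw α γ n ᵥ* growthMatrix α γ n

/-! ### The down-step -/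

/-- The least element of `S`, or `i` if `S` is empty. -/
def minOr (S : Finset (Fin n)) (i : Fin n) : Fin n :=
  if h : S.Nonempty then S.min' h else i

/-- The smallest leaf labels in the subtrees of the vertex `v`. -/
def leastLabels (t : LeafTree n) (v : Finset (Fin n)) : Finset (Fin n) :=
  {k | ∃ D ∈ t.children v, k ∈ D ∧ ∀ l ∈ D, k ≤ l}

/-- The position (starting from `1`) of `k` in the increasing enumeration of `L`, if `k ∈ L`. -/
def rank (L : Finset (Fin n)) (k : Fin n) : ℕ := #{l ∈ L | l ≤ k}

/-- The conditional probability that the leaf `k` is deleted, given the tree `t` and the selected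
leaf `i`.  Let `v` be the parent of `i` and `c` its number of children.  If `c = 2`, the deleted
leaf is `max {i, a, b}` where `a` and `b` are the least labels in the first and the second spinal
bush (an empty bush is ignored).  If `c > 2`, let `i_1 < ⋯ < i_c` be the least labels in the
subtrees of `v`, let `i = i_j` and `k = i_j'`; then the probability is read off the four cases.
If `(c - 2) α - γ = 0`, then `i_c` is deleted: for `c = 3` this is forced, and for `c > 3` it means
`α = γ = 0`.  (If `n = 1`, the only leaf is deleted.) -/
noncomputable def deletionProb (α γ : ℝ) (t : LeafTree n) (i k : Fin n) : ℝ :=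
  let v := t.parent {i}
  let c := #(t.children v)
  if c ≤ 2 then
    if k = max i (max (minOr (t.firstBush i) i) (minOr (t.secondBush i) i)) then 1 else 0
  else
    let L := t.leastLabels v
    let j := rank L i
    let j' := rank L k
    let d : ℝ := ((c : ℝ) - 2) * α - γ
    if k ∉ L then 0
    else if d = 0 then if j' = c then 1 else 0
    else if j ≤ 2 ∧ j' = 3 then (α - γ) / d
    else if j ≤ 2 ∧ 3 < j' then α / d
    else if 2 < j ∧ j < j' then α / d
    else if 2 < j ∧ j' = j then (((j : ℝ) - 2) * α - γ) / d
    else 0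

/-- The transition probabilities of the down-step: select a uniform leaf `i`, choose the leaf `k`
according to `deletionProb`, swap `i` and `k`, delete `k`, and relabel. -/
noncomputable def downMatrix (α γ : ℝ) (n : ℕ) : Matrix (LeafTree (n + 1)) (LeafTree n) ℝ :=
  fun t s => ∑ i, ∑ k,
    if (t.swap i k).delete k = s then 1 / ((n : ℝ) + 1) * t.deletionProb α γ i k else 0

/-- The transition matrix of the `(α, γ)`-chain on trees with `n` leaves: a down-step followed by
an up-step according to the growth rule. -/
noncomputable def chainMatrix (α γ : ℝ) : (n : ℕ) → Matrix (LeafTree n) (LeafTree n) ℝ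
  | 0 => 1
  | n + 1 => downMatrix α γ n * growthMatrix α γ n

end LeafTree

/-! ### Markov chains -/

/-- `X` is a Markov chain under `P`, the state space at time `k` being `S k` and the probability of
a transition from `x : S k` to `y : S (k + 1)` being `κ k x y`; the initial law is arbitrary. -/
structure IsMarkovChain {S : ℕ → Type*} [∀ k, MeasurableSpace (S k)]
    (κ : ∀ k, S k → S (k + 1) → ℝ) {Ω : Type*} [MeasurableSpace Ω] (P : Measure Ω)
    (X : ∀ k, Ω → S k) : Prop where
  measurable : ∀ k, Measurable (X k)
  transition : ∀ (k : ℕ) (x : ∀ j, S j),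
    P.real {ω | ∀ j ≤ k + 1, X j ω = x j} =
      P.real {ω | ∀ j ≤ k, X j ω = x j} * κ k (x k) (x (k + 1))

/-- `(T n)` is the `(α, γ)`-growth process: a Markov chain such that `T n` is a tree with `n`
leaves, and which evolves according to the `(α, γ)`-growth rule.  (There is just one tree with at
most one leaf, so that the time index `0` carries no information.) -/
def IsGrowthProcess (α γ : ℝ) {Ω : Type*} [MeasurableSpace Ω] (P : Measure Ω)
    (T : ∀ n, Ω → LeafTree n) : Prop :=
  IsMarkovChain (LeafTree.growthMatrix α γ) P T

/-- `(X m)` is an `(α, γ)`-chain on the trees with `n` leaves. -/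
def IsAlphaGammaChain (α γ : ℝ) (n : ℕ) {Ω : Type*} [MeasurableSpace Ω] (P : Measure Ω)
    (X : ℕ → Ω → LeafTree n) : Prop :=
  IsMarkovChain (S := fun _ => LeafTree n) (fun _ => LeafTree.chainMatrix α γ n) P X

/-!
The proof rests on a commutation relation between the up-step (insertion of a leaf) and the
down-step.  Write `G_n` for the growth matrix from trees with `n` leaves to trees with `n + 1`
leaves, and `D_n` for the down-step in the opposite direction, so that the chain on trees with
`n + 1` leaves has transition matrix `D_n G_n`.  For `n ≥ 3` leaves,

  `G_n D_n = a • 1 + b • D_{n-1} G_{n-1}`, with `a ≥ 0`, `b > 0`, `a + b = 1`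

(`growthMatrix_mul_downMatrix`).  The relation holds separately for each leaf `i` selected in the
down-step.  If `i` is the newly inserted leaf, then `i` itself is deleted, which undoes the
insertion (`deletionProb_last`).  If `i` is an old leaf with parent `v`, consider the part of the
tree that receives the new leaf.  After insertion into the edge of `i`, into `v`, or, if `v` is
binary, into the edge above `v`, the new leaf may take the role of `i`: then swapping and deleting
restores the original tree, and the total weight of this event is always `1`.  The remaining weight
is that of inserting into a part that survives the removal of `i`, and there insertion commutes with
deletion.  That the weights match is what the deletion probabilities at a vertex with more than two
children are designed for (`mul_rankProb_succ`, `mul_rankProb_succ_last`); at a binary vertex it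
rests on the deleted label being the largest of `i`, `a` and `b`.  The outcome is
`insertSum_deleteSum`.

Both halves of the theorem follow by induction on the number of leaves.  If the law `μ_n` of `T_n`
is invariant under the chain on trees with `n` leaves, then it is invariant under `G_n D_n`, hence
`μ_{n+1} D_n = μ_n G_n D_n = μ_n` and `μ_{n+1} D_n G_n = μ_{n+1}`.  As to uniqueness and
convergence, Doeblin's condition that some power of the transition matrix has a positive column
passes from the chain on `n` leaves to its lazy version `G_n D_n`, and from there to `D_n G_n`,
since `(D_n G_n)^(k+1) = D_n (G_n D_n)^k G_n`.  With at most two leaves there is only one tree.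

Trees with a leaf removed are handled through `comap`, the subtree spanned by the leaves in the
range of a relabelling.  Its vertices correspond to `survivors`, the vertices that do not disappear
with the leaf, and all the combinatorial data (children, parents, weights, insertions) are carried
along this correspondence.
-/

/-! ### Finite stochastic matrices -/

/-- A (possibly rectangular) matrix with nonnegative entries and row sums `1`. -/
def IsStochastic {S T : Type*} [Fintype T] (M : Matrix S T ℝ) : Prop :=
  (∀ i j, 0 ≤ M i j) ∧ ∀ i, ∑ j, M i j = 1

/-- Some power of the matrix has a column of positive entries: at some fixed time a fixed state is
reached with positive probability from every initial state. -/
def HasPositiveColumn {S : Type*} [Fintype S] [DecidableEq S] (M : Matrix S S ℝ) : Prop :=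
  ∃ (K : ℕ) (y : S), ∀ x, 0 < (M ^ K) x y

section Stochastic

variable {S T U : Type*} [Fintype T] [Fintype U]

lemma IsStochastic.mul {M : Matrix S T ℝ} {N : Matrix T U ℝ} (hM : IsStochastic M)
    (hN : IsStochastic N) : IsStochastic (M * N) := by
  refine ⟨fun i j => sum_nonneg fun k _ => mul_nonneg (hM.1 _ _) (hN.1 _ _), fun i => ?_⟩
  simp only [Matrix.mul_apply]
  rw [sum_comm]
  simp [← mul_sum, hN.2, hM.2]

variable [Fintype S]

lemma IsStochastic.vecMul_mem {M : Matrix S T ℝ} (hM : IsStochastic M) {u : S → ℝ}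
    (hu : u ∈ stdSimplex ℝ S) : u ᵥ* M ∈ stdSimplex ℝ T := by
  refine ⟨fun j => sum_nonneg fun k _ => mul_nonneg (hu.1 _) (hM.1 _ _), ?_⟩
  simp only [vecMul, dotProduct]
  rw [sum_comm]
  simp [← mul_sum, hM.2, hu.2]

lemma sum_vecMul_of_row_sums {M : Matrix S T ℝ} {c : ℝ} (hM : ∀ i, ∑ j, M i j = c) (u : S → ℝ) :
    ∑ j, (u ᵥ* M) j = c * ∑ i, u i := by
  simp only [vecMul, dotProduct]
  rw [sum_comm, mul_sum]
  exact sum_congr rfl fun i _ => by rw [← mul_sum, hM, mul_comm]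

lemma sum_abs_vecMul_le {M : Matrix S T ℝ} {c : ℝ} (h0 : ∀ i j, 0 ≤ M i j)
    (hM : ∀ i, ∑ j, M i j = c) (u : S → ℝ) : ∑ j, |(u ᵥ* M) j| ≤ c * ∑ i, |u i| := by
  rw [← sum_vecMul_of_row_sums hM]
  refine sum_le_sum fun j _ => (abs_sum_le_sum_abs _ _).trans (le_of_eq ?_)
  exact sum_congr rfl fun i _ => by rw [abs_mul, abs_of_nonneg (h0 i j)]

variable [DecidableEq S]

lemma IsStochastic.mem_rowStochastic {M : Matrix S S ℝ} (hM : IsStochastic M) :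
    M ∈ rowStochastic ℝ S := mem_rowStochastic_iff_sum.2 hM

lemma IsStochastic.pow {M : Matrix S S ℝ} (hM : IsStochastic M) (k : ℕ) :
    IsStochastic (M ^ k) :=
  mem_rowStochastic_iff_sum.1 (pow_mem hM.mem_rowStochastic k)

/-- Doeblin's contraction: signed vectors of total mass zero are driven to zero. -/
lemma IsStochastic.tendsto_vecMul_pow_zero {M : Matrix S S ℝ} (hM : IsStochastic M)
    (hpos : HasPositiveColumn M) {u : S → ℝ} (hu : ∑ i, u i = 0) :
    Tendsto (fun k => u ᵥ* M ^ k) atTop (nhds 0) := by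
  classical
  obtain ⟨K, y, hy⟩ := hpos
  rcases isEmpty_or_nonempty S with hS | hS
  · exact (tendsto_const_nhds (x := (0 : S → ℝ))).congr fun k => Subsingleton.elim _ _
  obtain ⟨x₀, hx₀⟩ := Finite.exists_min fun x => (M ^ K) x y
  set δ := (M ^ K) x₀ y with hδ
  have hδ0 : 0 < δ := hy x₀
  have hMK := hM.pow K
  have hδ1 : δ ≤ 1 := le_one_of_mem_rowStochastic hMK.mem_rowStochastic
  -- the part of `M ^ K` that is left after removing mass `δ` at `y` from every row
  let R : Matrix S S ℝ := fun i j => (M ^ K) i j - if j = y then δ else 0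
  have hR0 : ∀ i j, 0 ≤ R i j := by
    intro i j
    simp only [R]
    split_ifs with h
    · subst h; linarith [hx₀ i]
    · simpa using hMK.1 i j
  have hR1 : ∀ i, ∑ j, R i j = 1 - δ := by
    intro i
    simp [R, sum_sub_distrib, hMK.2]
  have hstep : ∀ w : S → ℝ, ∑ i, w i = 0 → ∑ j, |(w ᵥ* M ^ K) j| ≤ (1 - δ) * ∑ i, |w i| := by
    intro w hw
    have : w ᵥ* M ^ K = w ᵥ* R := by
      ext j
      simp only [vecMul, dotProduct, R, mul_sub, sum_sub_distrib, ← sum_mul, hw]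
      simp
    rw [this]
    exact sum_abs_vecMul_le hR0 hR1 w
  have hsum : ∀ k, ∑ i, (u ᵥ* M ^ k) i = 0 := fun k => by
    rw [sum_vecMul_of_row_sums (hM.pow k).2, hu, mul_zero]
  let a : ℕ → ℝ := fun k => ∑ i, |(u ᵥ* M ^ k) i|
  have ha0 : ∀ k, 0 ≤ a k := fun k => sum_nonneg fun _ _ => abs_nonneg _
  have hanti : Antitone a := antitone_nat_of_succ_le fun k => by
    have := sum_abs_vecMul_le hM.1 hM.2 (u ᵥ* M ^ k)
    rw [vecMul_vecMul, ← pow_succ, one_mul] at this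
    exact this
  have hgeo : ∀ k, a (K * k) ≤ (1 - δ) ^ k * a 0 := by
    intro k
    induction k with
    | zero => simp
    | succ k ih =>
      have := hstep _ (hsum (K * k))
      rw [vecMul_vecMul, ← pow_add] at this
      calc a (K * (k + 1)) ≤ (1 - δ) * a (K * k) := by rw [mul_add, mul_one]; exact this
        _ ≤ (1 - δ) * ((1 - δ) ^ k * a 0) := by gcongr
        _ = _ := by ring
  have ha : Tendsto a atTop (nhds 0) := by
    have hinf := tendsto_atTop_ciInf hanti ⟨0, by rintro _ ⟨k, rfl⟩; exact ha0 k⟩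
    have hle : ⨅ k, a k ≤ 0 := by
      have hlim : Tendsto (fun k => (1 - δ) ^ k * a 0) atTop (nhds 0) := by
        simpa using (tendsto_pow_atTop_nhds_zero_of_lt_one (by linarith) (by linarith)).mul_const
          (a 0)
      refine ge_of_tendsto' hlim fun k => (ciInf_le ?_ (K * k)).trans (hgeo k)
      exact ⟨0, by rintro _ ⟨k, rfl⟩; exact ha0 k⟩
    have hge : 0 ≤ ⨅ k, a k := le_ciInf ha0
    rwa [le_antisymm hle hge] at hinf
  rw [tendsto_pi_nhds]
  intro i
  refine squeeze_zero_norm (fun k => ?_) ha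
  exact single_le_sum (f := fun i => |(u ᵥ* M ^ k) i|) (fun _ _ => abs_nonneg _) (mem_univ i)

lemma IsStochastic.tendsto_vecMul_pow {M : Matrix S S ℝ} (hM : IsStochastic M)
    (hpos : HasPositiveColumn M) {μ ν : S → ℝ} (hμ : μ ∈ stdSimplex ℝ S)
    (hinv : μ ᵥ* M = μ) (hν : ν ∈ stdSimplex ℝ S) :
    Tendsto (fun k => ν ᵥ* M ^ k) atTop (nhds μ) := by
  have hk : ∀ k, μ ᵥ* M ^ k = μ := by
    intro k
    induction k with
    | zero => simp
    | succ k ih => rw [pow_succ, ← vecMul_vecMul, ih, hinv]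
  have h := (hM.tendsto_vecMul_pow_zero hpos (u := ν - μ)
    (by simp [sum_sub_distrib, hμ.2, hν.2])).add_const μ
  simpa [sub_vecMul, hk] using h

lemma IsStochastic.eq_of_vecMul_eq {M : Matrix S S ℝ} (hM : IsStochastic M)
    (hpos : HasPositiveColumn M) {μ ν : S → ℝ} (hμ : μ ∈ stdSimplex ℝ S)
    (hμM : μ ᵥ* M = μ) (hν : ν ∈ stdSimplex ℝ S) (hνM : ν ᵥ* M = ν) : ν = μ := by
  refine tendsto_nhds_unique ?_ (hM.tendsto_vecMul_pow hpos hμ hμM hν)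
  refine tendsto_const_nhds.congr fun k => ?_
  induction k with
  | zero => simp
  | succ k ih => rw [pow_succ, ← vecMul_vecMul, ← ih, hνM]

/-- Expanding the power binomially, all terms are nonnegative and one of them is `b ^ k • P ^ k`. -/
lemma pow_smul_pow_le {P : Matrix S S ℝ} {a b : ℝ} (ha : 0 ≤ a) (hb : 0 ≤ b)
    (hP : ∀ i j, 0 ≤ P i j) (k : ℕ) (i j : S) :
    0 ≤ (P ^ k) i j ∧ b ^ k * (P ^ k) i j ≤ ((a • (1 : Matrix S S ℝ) + b • P) ^ k) i j := by
  induction k generalizing i j with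
  | zero => simp [Matrix.one_apply]; split_ifs <;> norm_num
  | succ k ih =>
    simp only [pow_succ, Matrix.mul_apply, mul_sum]
    refine ⟨sum_nonneg fun l _ => mul_nonneg (ih i l).1 (hP _ _), sum_le_sum fun l _ => ?_⟩
    have h1 : b * P l j ≤ (a • (1 : Matrix S S ℝ) + b • P) l j := by
      simp only [Matrix.add_apply, Matrix.smul_apply, smul_eq_mul, Matrix.one_apply]
      split_ifs <;> simp [ha]
    calc b ^ k * b * ((P ^ k) i l * P l j) = (b ^ k * (P ^ k) i l) * (b * P l j) := by ring
      _ ≤ _ := mul_le_mul (ih i l).2 h1 (mul_nonneg hb (hP _ _))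
        ((mul_nonneg (pow_nonneg hb k) (ih i l).1).trans (ih i l).2)

lemma HasPositiveColumn.lazy {P : Matrix S S ℝ} {a b : ℝ} (h : HasPositiveColumn P) (ha : 0 ≤ a)
    (hb : 0 < b) (hP : ∀ i j, 0 ≤ P i j) :
    HasPositiveColumn (a • (1 : Matrix S S ℝ) + b • P) := by
  obtain ⟨K, y, hy⟩ := h
  exact ⟨K, y, fun x => (mul_pos (pow_pos hb K) (hy x)).trans_le
    (pow_smul_pow_le ha hb.le hP K x y).2⟩

lemma hasPositiveColumn_of_subsingleton [Subsingleton S] [Nonempty S] (M : Matrix S S ℝ) :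
    HasPositiveColumn M :=
  ⟨0, Classical.arbitrary S, fun x => by simp [Subsingleton.elim x (Classical.arbitrary S)]⟩

lemma mul_pow_succ_eq [DecidableEq T] (D : Matrix T S ℝ) (G : Matrix S T ℝ) (k : ℕ) :
    (D * G) ^ (k + 1) = D * (G * D) ^ k * G := by
  induction k with
  | zero => simp
  | succ k ih => rw [pow_succ, ih, pow_succ]; simp only [Matrix.mul_assoc]

/-- The property passes from the up-down chain to the down-up chain. -/
lemma HasPositiveColumn.mul_comm_of_isStochastic [DecidableEq T] {D : Matrix T S ℝ}
    {G : Matrix S T ℝ} (hD : IsStochastic D) (hG : IsStochastic G)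
    (h : HasPositiveColumn (G * D)) : HasPositiveColumn (D * G) := by
  obtain ⟨K, y, hy⟩ := h
  have hex : ∃ z, 0 < G y z := by
    by_contra! hcon
    have : ∑ z, G y z ≤ 0 := sum_nonpos fun z _ => hcon z
    linarith [hG.2 y]
  obtain ⟨z, hz⟩ := hex
  refine ⟨K + 1, z, fun x => ?_⟩
  have hGD : ∀ i j, 0 ≤ ((G * D) ^ K) i j := ((hG.mul hD).pow K).1
  have hDy : 0 < (D * (G * D) ^ K) x y := by
    rw [Matrix.mul_apply]
    have hex : ∃ w, 0 < D x w := by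
      by_contra! hcon
      have : ∑ w, D x w ≤ 0 := sum_nonpos fun w _ => hcon w
      linarith [hD.2 x]
    obtain ⟨w, hw⟩ := hex
    exact sum_pos' (fun i _ => mul_nonneg (hD.1 _ _) (hGD _ _))
      ⟨w, mem_univ _, mul_pos hw (hy w)⟩
  rw [mul_pow_succ_eq, Matrix.mul_apply]
  refine sum_pos' (fun i _ => mul_nonneg ?_ (hG.1 _ _)) ⟨y, mem_univ _, mul_pos hDy hz⟩
  exact sum_nonneg fun j _ => mul_nonneg (hD.1 _ _) (hGD _ _)

end Stochastic

/-! ### Laws of Markov chains -/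

section MarkovLaw

variable {S : ℕ → Type*} [∀ k, Fintype (S k)] [∀ k, MeasurableSpace (S k)]
  [∀ k, DiscreteMeasurableSpace (S k)] {κ : ∀ k, S k → S (k + 1) → ℝ}
  {Ω : Type*} [MeasurableSpace Ω] {P : Measure Ω} [IsProbabilityMeasure P] {X : ∀ k, Ω → S k}

lemma measureReal_eq_sum_fiber {A : Type*} [Fintype A] [MeasurableSpace A]
    [DiscreteMeasurableSpace A] {f : Ω → A} (hf : Measurable f) (s : Set Ω)
    (hs : MeasurableSet s) : P.real s = ∑ a, P.real {ω | f ω = a ∧ ω ∈ s} := by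
  classical
  have : s = ⋃ a ∈ (univ : Finset A), {ω | f ω = a ∧ ω ∈ s} := by
    ext ω; simp
  conv_lhs => rw [this]
  refine measureReal_biUnion_finset ?_ ?_
  · intro a _ b _ hab
    rw [Function.onFun, Set.disjoint_left]
    rintro ω ⟨h1, -⟩ ⟨h2, -⟩
    exact hab (h1.symm.trans h2)
  · intro a _
    exact (hf (MeasurableSet.of_discrete (s := {a}))).inter hs

/-- The one-step evolution of the law, obtained by summing the path probabilities over all
histories. -/
lemma IsMarkovChain.measureReal_succ (h : IsMarkovChain κ P X) (k : ℕ) (y : S (k + 1)) :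
    P.real {ω | X (k + 1) ω = y} = ∑ x, P.real {ω | X k ω = x} * κ k x y := by
  classical
  obtain ⟨ω₀⟩ : Nonempty Ω := by
    by_contra hne
    rw [not_nonempty_iff] at hne
    have h1 : P Set.univ = 1 := measure_univ
    rw [Set.eq_empty_of_isEmpty Set.univ, measure_empty] at h1
    exact zero_ne_one h1
  -- the history of the chain up to time `k`
  let H : Ω → ∀ j : Fin (k + 1), S j := fun ω j => X j ω
  have hH : Measurable H := measurable_pi_lambda _ fun j => h.measurable j
  -- a path that follows the history `a` up to time `k` and is at `y` at time `k + 1`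
  let path : (∀ j : Fin (k + 1), S j) → ∀ j, S j := fun a =>
    Function.update (fun j => if hj : j < k + 1 then a ⟨j, hj⟩ else X j ω₀) (k + 1) y
  have hpath : ∀ a j (hj : j < k + 1), path a j = a ⟨j, hj⟩ := by
    intro a j hj
    simp only [path]
    rw [Function.update_of_ne (by omega), dif_pos hj]
  have hpathy : ∀ a, path a (k + 1) = y := fun a => by simp [path]
  have hA : ∀ a, {ω | H ω = a} = {ω | ∀ j ≤ k, X j ω = path a j} := by
    intro a
    ext ω
    simp only [Set.mem_ofPred_eq]
    constructor
    · rintro rfl j hj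
      rw [hpath _ _ (by omega)]
    · intro hω
      ext ⟨j, hj⟩
      rw [← hpath a j hj]
      exact hω j (by omega)
  have hAy : ∀ a, {ω | H ω = a ∧ X (k + 1) ω = y} = {ω | ∀ j ≤ k + 1, X j ω = path a j} := by
    intro a
    ext ω
    have := Set.ext_iff.1 (hA a) ω
    simp only [Set.mem_ofPred_eq] at this ⊢
    rw [this]
    constructor
    · rintro ⟨h1, h2⟩ j hj
      rcases Nat.lt_or_ge j (k + 1) with hlt | hge
      · exact h1 j (by omega)
      · obtain rfl : j = k + 1 := by omega
        rw [hpathy, h2]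
    · intro h1
      exact ⟨fun j hj => h1 j (by omega), by rw [h1 _ le_rfl, hpathy]⟩
  have hms : ∀ j (x : S j), MeasurableSet {ω | X j ω = x} := fun j x =>
    h.measurable j (MeasurableSet.of_discrete (s := {x}))
  have hlast : ∀ a, path a k = a (Fin.last k) := fun a => hpath a k (by omega)
  rw [measureReal_eq_sum_fiber hH _ (hms (k + 1) y)]
  have hR : ∀ x : S k, P.real {ω | X k ω = x} =
      ∑ a, if a (Fin.last k) = x then P.real {ω | H ω = a} else 0 := by
    intro x
    rw [measureReal_eq_sum_fiber hH _ (hms k x)]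
    refine sum_congr rfl fun a _ => ?_
    split_ifs with hax
    · congr 1
      ext ω
      simp only [Set.mem_ofPred_eq, and_iff_left_iff_imp]
      rintro rfl
      exact hax
    · rw [← measureReal_empty (μ := P)]
      congr 1
      ext ω
      simp only [Set.mem_ofPred_eq, Set.mem_empty_iff_false, iff_false, not_and]
      rintro rfl h2
      exact hax h2
  simp only [hR, sum_mul, ite_mul, zero_mul]
  rw [sum_comm]
  refine sum_congr rfl fun a _ => ?_
  rw [sum_ite_eq, if_pos (mem_univ _)]
  simp only [Set.mem_ofPred_eq]
  rw [hAy, h.transition, ← hA, hlast, hpathy]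

lemma measureReal_fiber_mem_stdSimplex {A : Type*} [Fintype A] [MeasurableSpace A]
    [DiscreteMeasurableSpace A] {f : Ω → A} (hf : Measurable f) :
    (fun a => P.real {ω | f ω = a}) ∈ stdSimplex ℝ A := by
  refine ⟨fun a => measureReal_nonneg, ?_⟩
  have := measureReal_eq_sum_fiber (P := P) hf Set.univ MeasurableSet.univ
  simpa using this.symm

end MarkovLaw

lemma IsMarkovChain.law_eq_vecMul_pow {S : Type*} [Fintype S] [DecidableEq S] [MeasurableSpace S]
    [DiscreteMeasurableSpace S] {M : Matrix S S ℝ} {Ω : Type*} [MeasurableSpace Ω]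
    {P : Measure Ω} [IsProbabilityMeasure P] {X : ℕ → Ω → S}
    (h : IsMarkovChain (S := fun _ => S) (fun _ => M) P X) (k : ℕ) :
    (fun x => P.real {ω | X k ω = x}) = (fun x => P.real {ω | X 0 ω = x}) ᵥ* M ^ k := by
  induction k with
  | zero => simp
  | succ k ih =>
    rw [pow_succ, ← vecMul_vecMul, ← ih]
    ext y
    exact h.measureReal_succ k y

/-- On a finite discrete space, convergence of the point probabilities is convergence in
distribution. -/
lemma tendstoInDistribution_of_tendsto_measureReal {S : Type*} [Fintype S] [MeasurableSpace S]
    [DiscreteMeasurableSpace S] [TopologicalSpace S] [DiscreteTopology S]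
    {Ω Ω' : Type*} [MeasurableSpace Ω] [MeasurableSpace Ω'] {P : Measure Ω} {P' : Measure Ω'}
    [IsProbabilityMeasure P] [IsProbabilityMeasure P'] {X : ℕ → Ω → S} {Z : Ω' → S}
    (hX : ∀ k, Measurable (X k)) (hZ : Measurable Z)
    (h : ∀ s, Tendsto (fun k => P.real {ω | X k ω = s}) atTop (nhds (P'.real {ω | Z ω = s}))) :
    TendstoInDistribution X atTop Z (fun _ => P) P' where
  forall_aemeasurable k := (hX k).aemeasurable
  aemeasurable_limit := hZ.aemeasurable
  tendsto := by
    refine ProbabilityMeasure.tendsto_iff_forall_integral_tendsto.2 fun f => ?_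
    have key : ∀ (μ : Measure S) [IsFiniteMeasure μ], ∫ s, f s ∂μ = ∑ s, μ.real {s} * f s := by
      intro μ _
      rw [integral_fintype .of_finite]
      simp
    simp only [ProbabilityMeasure.coe_mk]
    have h1 : ∀ k, ∫ s, f s ∂(P.map (X k)) = ∑ s, P.real {ω | X k ω = s} * f s := by
      intro k
      have : IsProbabilityMeasure (P.map (X k)) :=
        Measure.isProbabilityMeasure_map (hX k).aemeasurable
      rw [key]
      refine sum_congr rfl fun s _ => ?_
      rw [map_measureReal_apply (hX k) (MeasurableSet.of_discrete)]
      rfl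
    have h2 : ∫ s, f s ∂(P'.map Z) = ∑ s, P'.real {ω | Z ω = s} * f s := by
      have : IsProbabilityMeasure (P'.map Z) := Measure.isProbabilityMeasure_map hZ.aemeasurable
      rw [key]
      refine sum_congr rfl fun s _ => ?_
      rw [map_measureReal_apply hZ (MeasurableSet.of_discrete)]
      rfl
    simp only [h1, h2]
    exact tendsto_finsetSum _ fun s _ => (h s).mul_const _

namespace LeafTree

/-! ### Children and parents -/

section Structure

variable {n : ℕ} (t : LeafTree n)

variable {t} in
lemma nonempty_of_mem {C : Finset (Fin n)} (hC : C ∈ t.clades) : C.Nonempty :=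
  nonempty_iff_ne_empty.2 fun h => t.empty_notMem (h ▸ hC)

variable {t} in
lemma subset_or_subset {C D : Finset (Fin n)} (hC : C ∈ t.clades) (hD : D ∈ t.clades)
    {x : Fin n} (hxC : x ∈ C) (hxD : x ∈ D) : C ⊆ D ∨ D ⊆ C :=
  (t.laminar C hC D hD).resolve_left fun h => disjoint_left.1 h hxC hxD

lemma mem_children {C D : Finset (Fin n)} :
    D ∈ t.children C ↔ D ∈ t.clades ∧ D ⊂ C ∧ ∀ E ∈ t.clades, D ⊂ E → ¬ E ⊂ C := by
  simp [children]

lemma disjoint_of_mem_children {C D E : Finset (Fin n)} (hD : D ∈ t.children C)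
    (hE : E ∈ t.children C) (hne : D ≠ E) : Disjoint D E := by
  rw [mem_children] at hD hE
  rcases t.laminar D hD.1 E hE.1 with h | h | h
  · exact h
  · exact absurd hE.2.1 (hD.2.2 E hE.1 (h.ssubset_of_ne hne))
  · exact absurd hD.2.1 (hE.2.2 D hD.1 (h.ssubset_of_ne hne.symm))

lemma exists_child_superset {C D : Finset (Fin n)} (hD : D ∈ t.clades) (hDC : D ⊂ C) :
    ∃ E ∈ t.children C, D ⊆ E := by
  obtain ⟨E, hDE, hE⟩ := ({E ∈ t.clades | E ⊂ C}).exists_le_maximal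
    (mem_filter.2 ⟨hD, hDC⟩)
  have hE1 := mem_filter.1 hE.1
  refine ⟨E, t.mem_children.2 ⟨hE1.1, hE1.2, fun F hF hEF hFC => ?_⟩, hDE⟩
  exact hEF.not_subset (hE.2 (mem_filter.2 ⟨hF, hFC⟩) hEF.subset)

lemma exists_child_mem {C : Finset (Fin n)} (hC : 2 ≤ #C) {x : Fin n} (hx : x ∈ C) :
    ∃ E ∈ t.children C, x ∈ E := by
  have h : ({x} : Finset (Fin n)) ⊂ C := by
    refine (singleton_subset_iff.2 hx).ssubset_of_ne fun h => ?_
    rw [← h, card_singleton] at hC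
    omega
  obtain ⟨E, hE, hxE⟩ := t.exists_child_superset (t.singleton_mem x) h
  exact ⟨E, hE, singleton_subset_iff.1 hxE⟩

lemma two_le_card_children {C : Finset (Fin n)} (hC : 2 ≤ #C) : 2 ≤ #(t.children C) := by
  obtain ⟨x, hx⟩ : C.Nonempty := card_pos.1 (by omega)
  obtain ⟨D, hD, -⟩ := t.exists_child_mem hC hx
  obtain ⟨y, hy, hyD⟩ := exists_of_ssubset (t.mem_children.1 hD).2.1
  obtain ⟨E, hE, hyE⟩ := t.exists_child_mem hC hy
  exact one_lt_card.2 ⟨D, hD, E, hE, fun h => hyD (h ▸ hyE)⟩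

lemma children_eq_empty {C : Finset (Fin n)} (hC : #C ≤ 1) : t.children C = ∅ := by
  refine eq_empty_of_forall_notMem fun D hD => ?_
  rw [mem_children] at hD
  have h1 := card_lt_card hD.2.1
  have h2 := (nonempty_of_mem hD.1).card_pos
  omega

variable {t}

/-- The vertices above a given one form a chain, so their intersection is one of them. -/
lemma parent_spec {C : Finset (Fin n)} (hC : C ∈ t.clades) (hne : C ≠ univ) :
    t.parent C ∈ t.clades ∧ C ⊂ t.parent C ∧ ∀ E ∈ t.clades, C ⊂ E → t.parent C ⊆ E := by
  obtain ⟨x, hx⟩ := nonempty_of_mem hC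
  have hu : univ ∈ ({D ∈ t.clades | C ⊂ D} : Finset (Finset (Fin n))) :=
    mem_filter.2 ⟨t.univ_mem x.pos, (subset_univ C).ssubset_of_ne hne⟩
  obtain ⟨V, -, hV⟩ := ({D ∈ t.clades | C ⊂ D}).exists_le_minimal hu
  have hV1 := mem_filter.1 hV.1
  have hleast : ∀ E ∈ t.clades, C ⊂ E → V ⊆ E := by
    intro E hE hCE
    rcases subset_or_subset hV1.1 hE (hV1.2.subset hx) (hCE.subset hx) with h | h
    · exact h
    · exact hV.2 (mem_filter.2 ⟨hE, hCE⟩) h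
  have heq : t.parent C = V := by
    refine subset_antisymm ?_ ?_
    · exact inf_le (f := id) hV.1
    · exact Finset.le_inf fun E hE => hleast E (mem_filter.1 hE).1 (mem_filter.1 hE).2
  rw [heq]
  exact ⟨hV1.1, hV1.2, hleast⟩

lemma parent_univ : t.parent univ = univ := by
  have : ({D ∈ t.clades | univ ⊂ D} : Finset (Finset (Fin n))) = ∅ :=
    filter_eq_empty_iff.2 fun D _ h => h.not_subset (subset_univ D)
  rw [parent, this, inf_empty]
  rfl

lemma parent_eq {C V : Finset (Fin n)} (hV : V ∈ t.clades) (hCV : C ⊂ V)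
    (h : ∀ E ∈ t.clades, C ⊂ E → V ⊆ E) (hC : C ∈ t.clades) : t.parent C = V := by
  have hne : C ≠ univ := fun h => (h ▸ hCV).not_subset (subset_univ V)
  have hs := parent_spec hC hne
  exact subset_antisymm (hs.2.2 V hV hCV) (h _ hs.1 hs.2.1)

lemma mem_children_iff {C V : Finset (Fin n)} (hC : C ∈ t.clades) (hV : V ∈ t.clades) :
    C ∈ t.children V ↔ C ≠ univ ∧ t.parent C = V := by
  rw [mem_children]
  constructor
  · rintro ⟨-, hCV, h⟩
    refine ⟨fun h => (h ▸ hCV).not_subset (subset_univ V), ?_⟩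
    refine parent_eq hV hCV (fun E hE hCE => ?_) hC
    obtain ⟨x, hx⟩ := nonempty_of_mem hC
    rcases subset_or_subset hV hE (hCV.subset hx) (hCE.subset hx) with h' | h'
    · exact h'
    · by_contra hcon
      exact h E hE hCE (h'.ssubset_of_not_subset hcon)
  · rintro ⟨hne, rfl⟩
    have hs := parent_spec hC hne
    exact ⟨hC, hs.2.1, fun E hE hCE hEV => hEV.not_subset (hs.2.2 E hE hCE)⟩

lemma singleton_ne_univ (hn : 2 ≤ n) (i : Fin n) : ({i} : Finset (Fin n)) ≠ univ := by
  intro h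
  have := congrArg card h
  rw [card_singleton, card_univ, Fintype.card_fin] at this
  omega

/-- Every vertex except the top one has exactly one parent. -/
lemma sum_card_children (hn : 1 ≤ n) : ∑ C ∈ t.clades, #(t.children C) + 1 = #t.clades := by
  have h : #(t.clades.erase univ) = ∑ C ∈ t.clades, #{D ∈ t.clades.erase univ | t.parent D = C} :=
    card_eq_sum_card_fiberwise fun D hD =>
      (parent_spec (mem_erase.1 hD).2 (mem_erase.1 hD).1).1
  rw [card_erase_of_mem (t.univ_mem hn)] at h
  have h' : ∀ C ∈ t.clades, #(t.children C) = #{D ∈ t.clades.erase univ | t.parent D = C} := by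
    intro C hC
    congr 1
    ext D
    simp only [mem_filter, mem_erase]
    constructor
    · intro hD
      have hDc := (t.mem_children.1 hD).1
      have := (mem_children_iff hDc hC).1 hD
      exact ⟨⟨this.1, hDc⟩, this.2⟩
    · rintro ⟨⟨h1, h2⟩, h3⟩
      exact (mem_children_iff h2 hC).2 ⟨h1, h3⟩
  rw [sum_congr rfl h', ← h]
  have : 0 < #t.clades := card_pos.2 ⟨univ, t.univ_mem hn⟩
  omega

lemma card_singleton_clades : #{C ∈ t.clades | #C = 1} = n := by
  have : ({C ∈ t.clades | #C = 1} : Finset (Finset (Fin n))) = univ.image fun i => {i} := by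
    ext C
    simp only [mem_filter, mem_image, mem_univ, true_and, card_eq_one]
    constructor
    · rintro ⟨-, i, rfl⟩
      exact ⟨i, rfl⟩
    · rintro ⟨i, rfl⟩
      exact ⟨t.singleton_mem i, i, rfl⟩
  rw [this, card_image_of_injective _ singleton_injective, card_univ, Fintype.card_fin]

/-- The star tree. -/
instance : Inhabited (LeafTree n) where
  default :=
    { clades := univ.image (fun i => {i}) ∪ univ.filter fun C => C = univ ∧ 0 < n
      empty_notMem := by
        intro h
        simp only [mem_union, mem_image, mem_univ, true_and, mem_filter] at h
        rcases h with ⟨i, hi⟩ | ⟨h, hn⟩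
        · exact singleton_ne_empty i hi
        · have := h ▸ mem_univ (⟨0, hn⟩ : Fin n)
          exact notMem_empty _ this
      singleton_mem := fun i => by simp
      univ_mem := fun hn => by simp [hn]
      laminar := by
        intro C hC D hD
        simp only [mem_union, mem_image, mem_univ, true_and, mem_filter] at hC hD
        rcases hC with ⟨i, rfl⟩ | ⟨rfl, -⟩
        · rcases hD with ⟨j, rfl⟩ | ⟨rfl, -⟩
          · by_cases hij : i = j
            · subst hij; simp
            · left; simpa using hij
          · simp
        · simp }

end Structure

/-! ### Restriction of a tree to a subset of its leaves -/

section Comap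

/-- The preimage of a set of labels under a relabelling. -/
def pre {p m : ℕ} (f : Fin p ↪ Fin m) (C : Finset (Fin m)) : Finset (Fin p) := {a | f a ∈ C}

@[simp] lemma mem_pre {p m : ℕ} {f : Fin p ↪ Fin m} {C : Finset (Fin m)} {a : Fin p} :
    a ∈ pre f C ↔ f a ∈ C := by simp [pre]

/-- The subtree spanned by the leaves in the range of `f`, relabelled along `f`. -/
def comap {p m : ℕ} (t : LeafTree m) (f : Fin p ↪ Fin m) : LeafTree p where
  clades := (t.clades.image (pre f)).erase ∅
  empty_notMem := by simp
  singleton_mem i := by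
    refine mem_erase.2 ⟨singleton_ne_empty i, mem_image.2 ⟨{f i}, t.singleton_mem _, ?_⟩⟩
    ext k
    simp
  univ_mem hp := by
    refine mem_erase.2 ⟨?_, mem_image.2 ⟨univ, t.univ_mem (f ⟨0, hp⟩).pos, ?_⟩⟩
    · exact nonempty_iff_ne_empty.1 ⟨⟨0, hp⟩, mem_univ _⟩
    · ext; simp
  laminar := by
    intro X hX Y hY
    obtain ⟨C, hC, rfl⟩ := mem_image.1 (mem_erase.1 hX).2
    obtain ⟨D, hD, rfl⟩ := mem_image.1 (mem_erase.1 hY).2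
    rcases t.laminar C hC D hD with h | h | h
    · left
      rw [disjoint_left]
      intro a ha hb
      exact disjoint_left.1 h (mem_pre.1 ha) (mem_pre.1 hb)
    · exact Or.inr (Or.inl fun a ha => mem_pre.2 (h (mem_pre.1 ha)))
    · exact Or.inr (Or.inr fun a ha => mem_pre.2 (h (mem_pre.1 ha)))

lemma mem_comap {p m : ℕ} {t : LeafTree m} {f : Fin p ↪ Fin m} {X : Finset (Fin p)} :
    X ∈ (t.comap f).clades ↔ X.Nonempty ∧ ∃ C ∈ t.clades, pre f C = X := by
  simp [comap, nonempty_iff_ne_empty]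

/-- The relabelling that implements "swap the labels `i` and `k`, delete leaf `k`". -/
def swapDelete {m : ℕ} (i k : Fin (m + 1)) : Fin m ↪ Fin (m + 1) :=
  k.succAboveEmb.trans (Equiv.swap i k).toEmbedding

lemma swapDelete_apply {m : ℕ} (i k : Fin (m + 1)) (a : Fin m) :
    swapDelete i k a = Equiv.swap i k (k.succAbove a) := rfl

lemma swap_delete_eq_comap {m : ℕ} (t : LeafTree (m + 1)) (i k : Fin (m + 1)) :
    (t.swap i k).delete k = t.comap (swapDelete i k) := by
  ext X : 2
  have : ∀ C : Finset (Fin (m + 1)),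
      ({a | k.succAbove a ∈ C.map (Equiv.swap i k).toEmbedding} : Finset (Fin m)) =
        pre (swapDelete i k) C := by
    intro C
    ext a
    simp [swapDelete_apply, mem_map_equiv]
  simp only [delete, swap, comap, image_image, Function.comp_def, this]

lemma range_swapDelete {m : ℕ} (i k : Fin (m + 1)) (x : Fin (m + 1)) :
    x ≠ i ↔ ∃ a, swapDelete i k a = x := by
  simp only [swapDelete_apply]
  constructor
  · intro h
    have hk : Equiv.swap i k x ≠ k := fun h' => h (by
      rw [← Equiv.swap_apply_self i k x, h', Equiv.swap_apply_right])
    obtain ⟨a, ha⟩ := Fin.exists_succAbove_eq hk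
    exact ⟨a, by rw [ha, Equiv.swap_apply_self]⟩
  · rintro ⟨a, rfl⟩ h
    have : k.succAbove a = k := by
      rw [← Equiv.swap_apply_self i k (k.succAbove a), h, Equiv.swap_apply_left]
    exact Fin.succAbove_ne _ _ this

variable {p m : ℕ} {t : LeafTree m} {f : Fin p ↪ Fin m} {i : Fin m}

/-- The vertices of `t` that represent those of the tree with leaf `i` removed: all but the leaf
`i` and, if the parent of `i` is binary, that parent (which then merges with the sibling of
`i`). -/
def survivors (t : LeafTree m) (i : Fin m) : Finset (Finset (Fin m)) :=
  {C ∈ t.clades | C ≠ {i} ∧ (i ∈ C → C.erase i ∉ t.clades)}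

lemma mem_survivors {C : Finset (Fin m)} :
    C ∈ t.survivors i ↔ C ∈ t.clades ∧ C ≠ {i} ∧ (i ∈ C → C.erase i ∉ t.clades) := by
  simp [survivors]

/-! In the following, the hypothesis `hf` says that `f` is a relabelling of all leaves except `i`.
-/

lemma pre_subset_pre_iff (hf : ∀ x, x ≠ i ↔ ∃ a, f a = x) {C D : Finset (Fin m)} :
    pre f C ⊆ pre f D ↔ C.erase i ⊆ D.erase i := by
  constructor
  · intro h x hx
    obtain ⟨hxi, hxC⟩ := mem_erase.1 hx
    obtain ⟨a, rfl⟩ := (hf x).1 hxi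
    exact mem_erase.2 ⟨hxi, mem_pre.1 (h (mem_pre.2 hxC))⟩
  · intro h a ha
    exact mem_pre.2 (mem_of_mem_erase (h (mem_erase.2 ⟨(hf _).2 ⟨a, rfl⟩, mem_pre.1 ha⟩)))

lemma pre_eq_pre_iff (hf : ∀ x, x ≠ i ↔ ∃ a, f a = x) {C D : Finset (Fin m)} :
    pre f C = pre f D ↔ C.erase i = D.erase i := by
  rw [subset_antisymm_iff, subset_antisymm_iff, pre_subset_pre_iff hf, pre_subset_pre_iff hf]

lemma card_pre (hf : ∀ x, x ≠ i ↔ ∃ a, f a = x) (C : Finset (Fin m)) :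
    #(pre f C) = #(C.erase i) := by
  rw [← card_map f]
  congr 1
  ext x
  simp only [Finset.mem_map, mem_pre, mem_erase]
  constructor
  · rintro ⟨a, ha, rfl⟩
    exact ⟨(hf _).2 ⟨a, rfl⟩, ha⟩
  · rintro ⟨hx, hxC⟩
    obtain ⟨a, rfl⟩ := (hf x).1 hx
    exact ⟨a, hxC, rfl⟩

lemma pre_nonempty (hf : ∀ x, x ≠ i ↔ ∃ a, f a = x) {C : Finset (Fin m)} (hC : C ∈ t.clades)
    (hne : C ≠ {i}) : (pre f C).Nonempty := by
  by_contra h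
  rw [not_nonempty_iff_eq_empty, ← card_eq_zero, card_pre hf, card_eq_zero] at h
  rcases (erase_eq_empty_iff _ _).1 h with h | h
  · exact t.empty_notMem (h ▸ hC)
  · exact hne h

lemma pre_singleton (hf : ∀ x, x ≠ i ↔ ∃ a, f a = x) : pre f {i} = ∅ := by
  rw [← card_eq_zero, card_pre hf, card_eq_zero]
  simp

lemma pre_mono {C D : Finset (Fin m)} (h : C ⊆ D) : pre f C ⊆ pre f D :=
  fun _ ha => mem_pre.2 (h (mem_pre.1 ha))

lemma ssubset_of_pre_ssubset {C D : Finset (Fin m)} (hC : C ∈ t.clades) (hD : D ∈ t.clades)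
    (hCne : (pre f C).Nonempty) (h : pre f C ⊂ pre f D) : C ⊂ D := by
  obtain ⟨a, ha⟩ := hCne
  rcases subset_or_subset hC hD (mem_pre.1 ha) (mem_pre.1 (h.subset ha)) with h' | h'
  · exact h'.ssubset_of_ne fun h'' => h.ne (h'' ▸ rfl)
  · exact absurd (pre_mono h') h.not_subset

/-- Survivors stay distinct when `i` is removed: two vertices can only merge if one of them is the
other with `i` added, and then the larger one is not a survivor. -/
lemma survivors_injOn (hf : ∀ x, x ≠ i ↔ ∃ a, f a = x) :
    Set.InjOn (pre f) (t.survivors i : Set (Finset (Fin m))) := by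
  have key : ∀ C ∈ t.survivors i, ∀ D ∈ t.survivors i, C.erase i = D.erase i → i ∈ C → i ∈ D := by
    intro C hC D hD h hiC
    by_contra hiD
    rw [mem_survivors] at hC hD
    rw [erase_eq_of_notMem hiD] at h
    exact hC.2.2 hiC (h ▸ hD.1)
  intro C hC D hD h
  rw [pre_eq_pre_iff hf] at h
  by_cases hi : i ∈ C
  · rw [← insert_erase hi, h, insert_erase (key C hC D hD h hi)]
  · have hi' : i ∉ D := fun h' => hi (key D hD C hC h.symm h')
    rwa [erase_eq_of_notMem hi, erase_eq_of_notMem hi'] at h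

/-- Every vertex except the leaf `i` merges with a survivor: a vertex that is lost is replaced by
the sibling of `i`. -/
lemma exists_survivor (hf : ∀ x, x ≠ i ↔ ∃ a, f a = x) {C : Finset (Fin m)} (hC : C ∈ t.clades)
    (hne : C ≠ {i}) : ∃ D ∈ t.survivors i, pre f D = pre f C ∧ D ⊆ C := by
  by_cases h : i ∈ C ∧ C.erase i ∈ t.clades
  · refine ⟨C.erase i, mem_survivors.2 ⟨h.2, fun h' => ?_, fun h' => ?_⟩, ?_, erase_subset _ _⟩
    · exact notMem_erase i C (h' ▸ mem_singleton_self i)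
    · exact absurd h' (notMem_erase i C)
    · rw [pre_eq_pre_iff hf, erase_idem]
  · exact ⟨C, mem_survivors.2 ⟨hC, hne, fun h1 h2 => h ⟨h1, h2⟩⟩, rfl, subset_rfl⟩

lemma comap_clades (hf : ∀ x, x ≠ i ↔ ∃ a, f a = x) :
    (t.comap f).clades = (t.survivors i).image (pre f) := by
  ext X
  rw [mem_comap, mem_image]
  constructor
  · rintro ⟨hX, C, hC, rfl⟩
    obtain ⟨D, hD, h, -⟩ := exists_survivor hf hC
      (fun h => hX.ne_empty (h ▸ pre_singleton hf))
    exact ⟨D, hD, h⟩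
  · rintro ⟨C, hC, rfl⟩
    have hC := mem_survivors.1 hC
    exact ⟨pre_nonempty hf hC.1 hC.2.1, C, hC.1, rfl⟩

lemma pre_mem_comap (hf : ∀ x, x ≠ i ↔ ∃ a, f a = x) {C : Finset (Fin m)} (hC : C ∈ t.clades)
    (hne : C ≠ {i}) : pre f C ∈ (t.comap f).clades :=
  mem_comap.2 ⟨pre_nonempty hf hC hne, C, hC, rfl⟩

lemma pre_ssubset_pre (hf : ∀ x, x ≠ i ↔ ∃ a, f a = x) {C D : Finset (Fin m)}
    (hC : C ∈ t.clades) (hD : D ∈ t.survivors i) (h : C ⊂ D) : pre f C ⊂ pre f D := by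
  refine (pre_mono h.subset).ssubset_of_ne fun heq => ?_
  rw [pre_eq_pre_iff hf] at heq
  have hiD : i ∈ D := by
    by_contra hi
    have hi' : i ∉ C := fun h' => hi (h.subset h')
    rw [erase_eq_of_notMem hi, erase_eq_of_notMem hi'] at heq
    exact h.ne heq
  have hiC : i ∉ C := fun hiC => h.ne (by rw [← insert_erase hiC, heq, insert_erase hiD])
  rw [erase_eq_of_notMem hiC] at heq
  exact (mem_survivors.1 hD).2.2 hiD (heq ▸ hC)

/-- On removing leaf `i`, the children of a surviving vertex are the traces of its old children,
apart from `i`.  (One of the children may be the parent of `i` and fail to survive; its trace is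
then that of the sibling of `i`.) -/
lemma children_comap (hf : ∀ x, x ≠ i ↔ ∃ a, f a = x) {C : Finset (Fin m)}
    (hC : C ∈ t.survivors i) :
    (t.comap f).children (pre f C) = ((t.children C).erase {i}).image (pre f) := by
  have hC' := mem_survivors.1 hC
  ext X
  rw [mem_image, mem_children]
  constructor
  · rintro ⟨hX, hXC, hmax⟩
    rw [comap_clades hf, mem_image] at hX
    obtain ⟨D, hD, rfl⟩ := hX
    have hD' := mem_survivors.1 hD
    have hDne := pre_nonempty hf hD'.1 hD'.2.1
    obtain ⟨E, hE, hDE⟩ :=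
      t.exists_child_superset hD'.1 (ssubset_of_pre_ssubset hD'.1 hC'.1 hDne hXC)
    have hE' := t.mem_children.1 hE
    have hEi : E ≠ {i} := by
      rintro rfl
      have := hDne.mono (pre_mono hDE)
      rw [pre_singleton hf] at this
      exact not_nonempty_empty this
    refine ⟨E, mem_erase.2 ⟨hEi, hE⟩, ?_⟩
    by_contra hne
    exact hmax _ (pre_mem_comap hf hE'.1 hEi) ((pre_mono hDE).ssubset_of_ne (Ne.symm hne))
      (pre_ssubset_pre hf hE'.1 hC hE'.2.1)
  · rintro ⟨D, hD, rfl⟩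
    obtain ⟨hDi, hD⟩ := mem_erase.1 hD
    have hD' := t.mem_children.1 hD
    refine ⟨pre_mem_comap hf hD'.1 hDi, pre_ssubset_pre hf hD'.1 hC hD'.2.1, ?_⟩
    intro X hX hDX hXC
    obtain ⟨hXne, E, hE, rfl⟩ := mem_comap.1 hX
    exact hD'.2.2 E hE (ssubset_of_pre_ssubset hD'.1 hE (pre_nonempty hf hD'.1 hDi) hDX)
      (ssubset_of_pre_ssubset hE hC'.1 hXne hXC)

lemma card_children_comap (hf : ∀ x, x ≠ i ↔ ∃ a, f a = x) {C : Finset (Fin m)}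
    (hC : C ∈ t.survivors i) :
    #((t.comap f).children (pre f C)) = #((t.children C).erase {i}) := by
  rw [children_comap hf hC]
  refine card_image_of_injOn fun D hD E hE h => ?_
  obtain ⟨hDi, hD⟩ := mem_erase.1 hD
  obtain ⟨hEi, hE⟩ := mem_erase.1 hE
  by_contra hne
  obtain ⟨a, ha⟩ := pre_nonempty hf (t.mem_children.1 hD).1 hDi
  have ha' : a ∈ pre f E := h ▸ ha
  exact disjoint_left.1 (t.disjoint_of_mem_children hD hE hne) (mem_pre.1 ha) (mem_pre.1 ha')

lemma parent_comap (hf : ∀ x, x ≠ i ↔ ∃ a, f a = x) {C : Finset (Fin m)} (hC : C ∈ t.clades)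
    (hCi : C ≠ {i}) (hCu : C ≠ univ) (hV : t.parent C ∈ t.survivors i) :
    (t.comap f).parent (pre f C) = pre f (t.parent C) := by
  have hs := parent_spec hC hCu
  refine parent_eq (pre_mem_comap hf hs.1 (mem_survivors.1 hV).2.1)
    (pre_ssubset_pre hf hC hV hs.2.1) (fun X hX hCX => ?_) (pre_mem_comap hf hC hCi)
  obtain ⟨-, E, hE, rfl⟩ := mem_comap.1 hX
  exact pre_mono (hs.2.2 E hE (ssubset_of_pre_ssubset hC hE (pre_nonempty hf hC hCi) hCX))

/-! ### The parent of a leaf -/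

/-- A vertex is lost on removing leaf `i` only if it is the parent of `i`, with two children. -/
lemma eq_parent_of_erase_mem (hm : 2 ≤ m) {C : Finset (Fin m)} (hC : C ∈ t.clades) (hi : i ∈ C)
    (h : C.erase i ∈ t.clades) : C = t.parent {i} ∧ #(t.children C) = 2 := by
  have hd : ∀ D ∈ t.clades, {i} ⊂ D → C ⊆ D := by
    intro D hD hiD
    obtain ⟨y, hyD, hyi⟩ := exists_of_ssubset hiD
    rcases subset_or_subset hC hD hi (hiD.subset (mem_singleton_self i)) with h' | h'
    · exact h'
    · rcases subset_or_subset h hD (mem_erase.2 ⟨fun h => hyi (mem_singleton.2 h), h' hyD⟩) hyD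
        with h'' | h''
      · rw [← insert_erase hi]
        exact insert_subset (hiD.subset (mem_singleton_self i)) h''
      · exact absurd (h'' (hiD.subset (mem_singleton_self i))) (notMem_erase i C)
  obtain ⟨y, hy⟩ := nonempty_of_mem h
  have hiC : {i} ⊂ C := (ssubset_iff_of_subset (singleton_subset_iff.2 hi)).2
    ⟨y, mem_of_mem_erase hy, fun h' => (mem_erase.1 hy).1 (mem_singleton.1 h')⟩
  refine ⟨(parent_eq hC hiC hd (t.singleton_mem i)).symm, ?_⟩
  have hich : {i} ∈ t.children C := (mem_children_iff (t.singleton_mem i) hC).2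
    ⟨singleton_ne_univ hm i, parent_eq hC hiC hd (t.singleton_mem i)⟩
  have hsub : t.children C ⊆ {{i}, C.erase i} := by
    intro D hD
    rw [mem_insert, mem_singleton, or_iff_not_imp_left]
    intro hDi
    have hdis := t.disjoint_of_mem_children hD hich hDi
    have hD' := t.mem_children.1 hD
    have hDs : D ⊆ C.erase i := fun x hx => mem_erase.2
      ⟨fun hxi => disjoint_left.1 hdis hx (mem_singleton.2 hxi), hD'.2.1.subset hx⟩
    by_contra hne
    exact hD'.2.2 _ h (hDs.ssubset_of_ne hne) (erase_ssubset hi)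
  have h2 : 2 ≤ #C := by
    have := card_lt_card hiC
    rw [card_singleton] at this
    omega
  exact le_antisymm ((card_le_card hsub).trans card_le_two) (t.two_le_card_children h2)

lemma erase_mem_of_card_children {C : Finset (Fin m)} (hi : {i} ∈ t.children C)
    (h2 : #(t.children C) ≤ 2) : C.erase i ∈ t.clades := by
  have hi' := t.mem_children.1 hi
  have hiC : i ∈ C := hi'.2.1.subset (mem_singleton_self i)
  have hC2 : 2 ≤ #C := by
    have := card_lt_card hi'.2.1
    rw [card_singleton] at this
    omega
  obtain ⟨y, hy, hyi⟩ := exists_of_ssubset hi'.2.1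
  obtain ⟨D, hD, hyD⟩ := t.exists_child_mem hC2 hy
  have hDi : D ≠ {i} := fun h => hyi (h ▸ hyD)
  have hD' := t.mem_children.1 hD
  suffices D = C.erase i from this ▸ hD'.1
  refine subset_antisymm (fun x hx => mem_erase.2 ⟨?_, hD'.2.1.subset hx⟩) fun x hx => ?_
  · rintro rfl
    exact disjoint_left.1 (t.disjoint_of_mem_children hD hi hDi) hx (mem_singleton_self x)
  · obtain ⟨hxi, hxC⟩ := mem_erase.1 hx
    obtain ⟨E, hE, hxE⟩ := t.exists_child_mem hC2 hxC
    by_contra hxD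
    have : ({{i}, D, E} : Finset (Finset (Fin m))) ⊆ t.children C := by
      intro F hF
      simp only [mem_insert, mem_singleton] at hF
      rcases hF with rfl | rfl | rfl <;> assumption
    have h3 := card_le_card this
    rw [card_eq_three.2 ⟨{i}, D, E, hDi.symm, fun h => hxi (mem_singleton.1 (h ▸ hxE)),
      fun h => hxD (h ▸ hxE), rfl⟩] at h3
    omega

lemma singleton_mem_children_parent (hm : 2 ≤ m) (t : LeafTree m) (i : Fin m) :
    {i} ∈ t.children (t.parent {i}) :=
  (mem_children_iff (t.singleton_mem i)
    (parent_spec (t.singleton_mem i) (singleton_ne_univ hm i)).1).2 ⟨singleton_ne_univ hm i, rfl⟩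

lemma two_le_card_parent (hm : 2 ≤ m) (t : LeafTree m) (i : Fin m) : 2 ≤ #(t.parent {i}) := by
  have := card_lt_card (parent_spec (t.singleton_mem i) (singleton_ne_univ hm i)).2.1
  rwa [card_singleton] at this

lemma mem_survivors_of_ne_parent (hm : 2 ≤ m) {C : Finset (Fin m)} (hC : C ∈ t.clades)
    (hne : C ≠ {i}) (hp : C ≠ t.parent {i}) : C ∈ t.survivors i :=
  mem_survivors.2 ⟨hC, hne, fun hi h => hp (eq_parent_of_erase_mem hm hC hi h).1⟩

lemma parent_mem_survivors_iff (hm : 2 ≤ m) (t : LeafTree m) (i : Fin m) :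
    t.parent {i} ∈ t.survivors i ↔ 2 < #(t.children (t.parent {i})) := by
  have hs := parent_spec (t.singleton_mem i) (singleton_ne_univ hm i)
  rw [mem_survivors]
  constructor
  · rintro ⟨-, -, h⟩
    by_contra! h'
    exact h (hs.2.1.subset (mem_singleton_self i))
      (erase_mem_of_card_children (singleton_mem_children_parent hm t i) h')
  · intro h
    refine ⟨hs.1, hs.2.1.ne', fun hi h' => ?_⟩
    have := (eq_parent_of_erase_mem hm hs.1 hi h').2
    omega

end Comap

/-! ### The deletion probabilities -/

section Rank

variable {n : ℕ}

lemma rank_pos {L : Finset (Fin n)} {k : Fin n} (hk : k ∈ L) : 0 < rank L k :=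
  card_pos.2 ⟨k, mem_filter.2 ⟨hk, le_rfl⟩⟩

lemma rank_le (L : Finset (Fin n)) (k : Fin n) : rank L k ≤ #L := card_filter_le _ _

lemma rank_lt_rank {L : Finset (Fin n)} {k l : Fin n} (hl : l ∈ L) (h : k < l) :
    rank L k < rank L l := by
  refine card_lt_card ((ssubset_iff_of_subset ?_).2 ⟨l, ?_, ?_⟩)
  · intro x hx
    have hx := mem_filter.1 hx
    exact mem_filter.2 ⟨hx.1, hx.2.trans h.le⟩
  · exact mem_filter.2 ⟨hl, le_rfl⟩
  · exact fun h' => (mem_filter.1 h').2.not_gt h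

lemma rank_injOn (L : Finset (Fin n)) : Set.InjOn (rank L) L := by
  intro k hk l hl h
  rcases lt_trichotomy k l with h' | h' | h'
  · exact absurd h (rank_lt_rank hl h').ne
  · exact h'
  · exact absurd h (rank_lt_rank hk h').ne'

lemma image_rank (L : Finset (Fin n)) : L.image (rank L) = Icc 1 #L := by
  refine eq_of_subset_of_card_le ?_ ?_
  · intro j hj
    obtain ⟨k, hk, rfl⟩ := mem_image.1 hj
    exact mem_Icc.2 ⟨rank_pos hk, rank_le L k⟩
  · rw [card_image_of_injOn (rank_injOn L), Nat.card_Icc, Nat.add_sub_cancel]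

lemma sum_rank (L : Finset (Fin n)) (g : ℕ → ℝ) : ∑ k ∈ L, g (rank L k) = ∑ j ∈ Icc 1 #L, g j := by
  rw [← image_rank, sum_image (rank_injOn L)]

/-- The probability of deleting the leaf `i_j'` when the leaf `i_j` has been selected, at a vertex
with `c > 2` children. -/
noncomputable def rankProb (α γ : ℝ) (c j j' : ℕ) : ℝ :=
  let d : ℝ := ((c : ℝ) - 2) * α - γ
  if d = 0 then if j' = c then 1 else 0
  else if j ≤ 2 ∧ j' = 3 then (α - γ) / d
  else if j ≤ 2 ∧ 3 < j' then α / d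
  else if 2 < j ∧ j < j' then α / d
  else if 2 < j ∧ j' = j then (((j : ℝ) - 2) * α - γ) / d
  else 0

lemma deletionProb_of_le (α γ : ℝ) (t : LeafTree n) (i k : Fin n)
    (hc : #(t.children (t.parent {i})) ≤ 2) :
    t.deletionProb α γ i k =
      if k = max i (max (minOr (t.firstBush i) i) (minOr (t.secondBush i) i)) then 1 else 0 := by
  simp only [deletionProb, if_pos hc]

lemma deletionProb_of_lt (α γ : ℝ) (t : LeafTree n) (i k : Fin n)
    (hc : 2 < #(t.children (t.parent {i}))) :
    t.deletionProb α γ i k =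
      if k ∈ t.leastLabels (t.parent {i}) then
        rankProb α γ #(t.children (t.parent {i})) (rank (t.leastLabels (t.parent {i})) i)
          (rank (t.leastLabels (t.parent {i})) k)
      else 0 := by
  simp only [deletionProb, if_neg hc.not_ge, rankProb, ite_not]

variable {α γ : ℝ}

lemma rankProb_nonneg (hγα : γ ≤ α) (hα : 0 ≤ α) {c : ℕ} (hc : 2 < c)
    (j j' : ℕ) : 0 ≤ rankProb α γ c j j' := by
  have hc' : (3 : ℝ) ≤ c := by exact_mod_cast hc
  have hd : 0 ≤ ((c : ℝ) - 2) * α - γ := by nlinarith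
  simp only [rankProb]
  split_ifs with h1 h2 h3 h4 h5 h6
  · exact zero_le_one
  · exact le_rfl
  · exact div_nonneg (by linarith) hd
  · exact div_nonneg hα hd
  · exact div_nonneg hα hd
  · have : (3 : ℝ) ≤ j := by exact_mod_cast h6.1
    exact div_nonneg (by nlinarith) hd
  · exact le_rfl

lemma sum_rankProb {c j : ℕ} (hc : 2 < c) (hjc : j ≤ c) :
    ∑ j' ∈ Icc 1 c, rankProb α γ c j j' = 1 := by
  simp only [rankProb]
  by_cases hd : ((c : ℝ) - 2) * α - γ = 0
  · simp only [if_pos hd]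
    rw [sum_ite_eq' (Icc 1 c) c, if_pos (mem_Icc.2 ⟨by omega, le_rfl⟩)]
  simp only [if_neg hd]
  rcases Nat.lt_or_ge 2 j with hj | hj
  · have h : ∀ j' ∈ Icc 1 c, (if j ≤ 2 ∧ j' = 3 then (α - γ) / (((c : ℝ) - 2) * α - γ)
        else if j ≤ 2 ∧ 3 < j' then α / (((c : ℝ) - 2) * α - γ)
        else if 2 < j ∧ j < j' then α / (((c : ℝ) - 2) * α - γ)
        else if 2 < j ∧ j' = j then (((j : ℝ) - 2) * α - γ) / (((c : ℝ) - 2) * α - γ) else 0) =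
        (if j' ∈ Ioc j c then α / (((c : ℝ) - 2) * α - γ) else 0) +
        if j' = j then (((j : ℝ) - 2) * α - γ) / (((c : ℝ) - 2) * α - γ) else 0 := by
      intro j' hj'
      have := (mem_Icc.1 hj')
      rw [if_neg (by omega), if_neg (by omega)]
      by_cases h1 : j < j'
      · rw [if_pos ⟨hj, h1⟩, if_pos (mem_Ioc.2 ⟨h1, this.2⟩), if_neg (by omega), add_zero]
      · rw [if_neg (by omega), if_neg (fun h => h1 (mem_Ioc.1 h).1), zero_add]
        simp [hj]
    rw [sum_congr rfl h, sum_add_distrib, sum_ite_eq', if_pos (mem_Icc.2 ⟨by omega, hjc⟩),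
      sum_ite_mem, inter_eq_right.2, sum_const, Nat.card_Ioc, nsmul_eq_mul, Nat.cast_sub hjc]
    · rw [← mul_div_assoc, ← add_div, div_eq_one_iff_eq hd]
      ring
    · intro x hx
      have := mem_Ioc.1 hx
      exact mem_Icc.2 ⟨by omega, this.2⟩
  · have h : ∀ j' ∈ Icc 1 c, (if j ≤ 2 ∧ j' = 3 then (α - γ) / (((c : ℝ) - 2) * α - γ)
        else if j ≤ 2 ∧ 3 < j' then α / (((c : ℝ) - 2) * α - γ)
        else if 2 < j ∧ j < j' then α / (((c : ℝ) - 2) * α - γ)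
        else if 2 < j ∧ j' = j then (((j : ℝ) - 2) * α - γ) / (((c : ℝ) - 2) * α - γ) else 0) =
        (if j' ∈ Ioc 3 c then α / (((c : ℝ) - 2) * α - γ) else 0) +
        if j' = 3 then (α - γ) / (((c : ℝ) - 2) * α - γ) else 0 := by
      intro j' hj'
      have := (mem_Icc.1 hj')
      by_cases h1 : j' = 3
      · rw [if_pos ⟨hj, h1⟩, if_neg (by simp [h1]), if_pos h1, zero_add]
      · rw [if_neg (by omega), if_neg h1, add_zero]
        by_cases h2 : 3 < j'
        · rw [if_pos ⟨hj, h2⟩, if_pos (mem_Ioc.2 ⟨h2, this.2⟩)]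
        · rw [if_neg (by omega), if_neg (by omega), if_neg (by omega),
            if_neg (fun h => h2 (mem_Ioc.1 h).1)]
    rw [sum_congr rfl h, sum_add_distrib, sum_ite_eq', if_pos (mem_Icc.2 ⟨by omega, hc⟩),
      sum_ite_mem, inter_eq_right.2, sum_const, Nat.card_Ioc, nsmul_eq_mul, Nat.cast_sub hc]
    · rw [← mul_div_assoc, ← add_div, div_eq_one_iff_eq hd]
      push_cast
      ring
    · intro x hx
      have := mem_Ioc.1 hx
      exact mem_Icc.2 ⟨by omega, this.2⟩

lemma mul_div_cancel_of_ne {d : ℝ} (hd : d ≠ 0) (y : ℝ) : d * (y / d) = y := by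
  field_simp

/-- At a vertex with `c ≥ 3` children that receives one more child, the old deletion probabilities
are rescaled by the ratio of two insertion weights of the vertex: that with one child less, and that
with its original `c` children. -/
lemma mul_rankProb_succ (hγ : 0 ≤ γ) (hγα : γ ≤ α) {c j j' : ℕ} (hc : 2 < c) (hj' : j' ≤ c) :
    (((c : ℝ) - 1) * α - γ) * rankProb α γ (c + 1) j j' =
      (((c : ℝ) - 2) * α - γ) * rankProb α γ c j j' := by
  have hc' : (3 : ℝ) ≤ c := by exact_mod_cast hc
  have hα : 0 ≤ α := hγ.trans hγα
  have he : (((c + 1 : ℕ) : ℝ) - 2) * α - γ = ((c : ℝ) - 1) * α - γ := by push_cast; ring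
  simp only [rankProb, he]
  by_cases hd' : ((c : ℝ) - 1) * α - γ = 0
  · have hα0 : α = 0 := by nlinarith
    have hγ0 : γ = 0 := by linarith
    simp [hα0, hγ0]
  rw [if_neg hd']
  by_cases hd : ((c : ℝ) - 2) * α - γ = 0
  · -- here `α = γ > 0` and `c = 3`, so that the numerators vanish
    have hα0 : α ≠ 0 := by
      rintro rfl
      exact hd' (by linarith)
    have hαpos : 0 < α := lt_of_le_of_ne hα hα0.symm
    have hc3 : c = 3 := by
      by_contra h
      have : (4 : ℝ) ≤ c := by
        have : 4 ≤ c := by omega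
        exact_mod_cast this
      nlinarith
    subst hc3
    have hαγ : α - γ = 0 := by push_cast at hd; linarith
    rw [hd, zero_mul, mul_eq_zero]
    right
    split_ifs with h1 h2 h3 h4
    · rw [hαγ, zero_div]
    · omega
    · omega
    · obtain rfl : j = 3 := by omega
      rw [div_eq_zero_iff]
      left
      push_cast
      linarith
    · rfl
  rw [if_neg hd]
  split_ifs <;> first
    | rw [mul_div_cancel_of_ne hd', mul_div_cancel_of_ne hd]
    | rw [mul_zero, mul_zero]

/-- At a vertex with `c ≥ 3` children, the weight of inserting the new leaf there and then deleting
it is `α`, whichever child is selected. -/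
lemma mul_rankProb_succ_last (hγ : 0 ≤ γ) (hγα : γ ≤ α) {c j : ℕ} (hc : 2 < c) (hj : j ≤ c) :
    (((c : ℝ) - 1) * α - γ) * rankProb α γ (c + 1) j (c + 1) = α := by
  have hc' : (3 : ℝ) ≤ c := by exact_mod_cast hc
  have hα : 0 ≤ α := hγ.trans hγα
  have he : (((c + 1 : ℕ) : ℝ) - 2) * α - γ = ((c : ℝ) - 1) * α - γ := by push_cast; ring
  simp only [rankProb, he]
  by_cases hd' : ((c : ℝ) - 1) * α - γ = 0
  · have hα0 : α = 0 := by nlinarith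
    rw [hd', zero_mul, hα0]
  rw [if_neg hd', if_neg (by omega)]
  by_cases hj2 : j ≤ 2
  · rw [if_pos (by omega), mul_div_cancel_of_ne hd']
  · rw [if_neg (by omega), if_pos (by omega), mul_div_cancel_of_ne hd']

/-- The leaf in the last position is deleted if it is the selected one. -/
lemma rankProb_self {c j' : ℕ} (hc : 2 < c) (hj' : j' ≤ c) :
    rankProb α γ c c j' = if j' = c then 1 else 0 := by
  simp only [rankProb]
  split_ifs with h1 h2 h3 h4 h5 h6 h7 <;> try omega
  all_goals first | rfl | exact div_self h1

/-- At a vertex with three children, the third one is deleted if one of the first two is selected.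
-/
lemma rankProb_three {j j' : ℕ} (hj : j ≤ 2) (hj' : j' ≤ 3) :
    rankProb α γ 3 j j' = if j' = 3 then 1 else 0 := by
  simp only [rankProb]
  by_cases h0 : ((3 : ℕ) - 2 : ℝ) * α - γ = 0
  · rw [if_pos h0]
  · rw [if_neg h0]
    by_cases h3 : j' = 3
    · rw [if_pos ⟨hj, h3⟩, if_pos h3, div_eq_one_iff_eq h0]
      push_cast
      ring
    · rw [if_neg (by omega), if_neg (by omega), if_neg (by omega), if_neg (by omega), if_neg h3]

end Rank

section LeastLabels

variable {n : ℕ} {t : LeafTree n}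

lemma mem_leastLabels {v : Finset (Fin n)} {k : Fin n} :
    k ∈ t.leastLabels v ↔ ∃ D ∈ t.children v, k ∈ D ∧ ∀ l ∈ D, k ≤ l := by
  simp [leastLabels]

lemma mem_leastLabels_of_singleton {v : Finset (Fin n)} {k : Fin n} (h : {k} ∈ t.children v) :
    k ∈ t.leastLabels v :=
  mem_leastLabels.2 ⟨{k}, h, mem_singleton_self k, fun _ hl => (mem_singleton.1 hl).ge⟩

lemma card_leastLabels (t : LeafTree n) (v : Finset (Fin n)) :
    #(t.leastLabels v) = #(t.children v) := by
  refine (card_bij (fun D hD => D.min' (nonempty_of_mem (t.mem_children.1 hD).1)) ?_ ?_ ?_).symm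
  · intro D hD
    exact mem_leastLabels.2 ⟨D, hD, min'_mem _ _, fun l hl => min'_le _ _ hl⟩
  · intro D hD E hE h
    by_contra hne
    have h1 := min'_mem D (nonempty_of_mem (t.mem_children.1 hD).1)
    rw [h] at h1
    exact disjoint_left.1 (t.disjoint_of_mem_children hD hE hne) h1 (min'_mem _ _)
  · intro k hk
    obtain ⟨D, hD, hkD, hmin⟩ := mem_leastLabels.1 hk
    exact ⟨D, hD, le_antisymm (min'_le _ _ hkD) (le_min' _ _ _ hmin)⟩

variable {α γ : ℝ}

lemma deletionProb_nonneg (hγα : γ ≤ α) (hα : 0 ≤ α) (t : LeafTree n) (i k : Fin n) :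
    0 ≤ t.deletionProb α γ i k := by
  rcases Nat.lt_or_ge 2 #(t.children (t.parent {i})) with hc | hc
  · rw [deletionProb_of_lt α γ t i k hc]
    split_ifs
    · exact rankProb_nonneg hγα hα hc _ _
    · exact le_rfl
  · rw [deletionProb_of_le α γ t i k hc]
    split_ifs <;> norm_num

lemma sum_deletionProb (α γ : ℝ) (t : LeafTree n) (i : Fin n) :
    ∑ k, t.deletionProb α γ i k = 1 := by
  rcases Nat.lt_or_ge 2 #(t.children (t.parent {i})) with hc | hc
  · simp only [deletionProb_of_lt α γ t i _ hc]
    rw [sum_ite_mem, univ_inter,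
      sum_rank _ (rankProb α γ #(t.children (t.parent {i})) _), card_leastLabels]
    refine sum_rankProb hc ?_
    rw [← card_leastLabels]
    exact rank_le _ _
  · simp only [deletionProb_of_le α γ t i _ hc]
    rw [sum_ite_eq', if_pos (mem_univ _)]

/-- If the selected leaf has the largest label, then it is deleted. -/
lemma deletionProb_last {m : ℕ} (hm : 1 ≤ m) (α γ : ℝ) (T : LeafTree (m + 1)) (k : Fin (m + 1)) :
    T.deletionProb α γ (Fin.last m) k = if k = Fin.last m then 1 else 0 := by
  have hL := mem_leastLabels_of_singleton
    (singleton_mem_children_parent (by omega) T (Fin.last m))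
  rcases Nat.lt_or_ge 2 #(T.children (T.parent {Fin.last m})) with hc | hc
  · rw [deletionProb_of_lt α γ T _ k hc, ← card_leastLabels]
    rw [← card_leastLabels] at hc
    have hr : rank (T.leastLabels (T.parent {Fin.last m})) (Fin.last m) =
        #(T.leastLabels (T.parent {Fin.last m})) := by
      rw [rank, filter_true_of_mem fun l _ => Fin.le_last l]
    rw [hr, rankProb_self hc (rank_le _ _)]
    by_cases hk : k = Fin.last m
    · subst hk
      rw [if_pos hL, if_pos hr, if_pos rfl]
    · rw [if_neg hk]
      split_ifs with h1 h2
      · exact absurd (rank_injOn _ h1 hL (h2.trans hr.symm)) hk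
      · rfl
      · rfl
  · rw [deletionProb_of_le α γ T _ k hc, max_eq_left (Fin.le_last _)]

/-- The down-step is stochastic. -/
lemma isStochastic_downMatrix (hγα : γ ≤ α) (hα : 0 ≤ α) (n : ℕ) :
    IsStochastic (downMatrix α γ n) := by
  constructor
  · intro t s
    refine sum_nonneg fun i _ => sum_nonneg fun k _ => ?_
    split_ifs
    · exact mul_nonneg (by positivity) (deletionProb_nonneg hγα hα _ _ _)
    · exact le_rfl
  · intro t
    simp only [downMatrix]
    rw [sum_comm]
    simp only [fun i => sum_comm (s := univ (α := LeafTree n)) (t := univ (α := Fin (n + 1)))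
      (f := fun s k => if (t.swap i k).delete k = s then
        1 / ((n : ℝ) + 1) * t.deletionProb α γ i k else 0), sum_ite_eq, mem_univ, if_true,
      ← mul_sum, sum_deletionProb, sum_const, card_univ, Fintype.card_fin, nsmul_eq_mul]
    push_cast
    field_simp

end LeastLabels

/-! ### The growth step -/

section Growth

variable {n : ℕ} (t : LeafTree n)

/-- Insertion of the last leaf into the edge below the vertex `C`, as a total function of `C`. -/
noncomputable def edgeTree (C : Finset (Fin n)) : LeafTree (n + 1) :=
  if h : C ∈ t.clades then t.insertEdge ⟨C, h⟩ else default

/-- Insertion of the last leaf into the branch point `C`, as a total function of `C`. -/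
noncomputable def branchTree (C : Finset (Fin n)) : LeafTree (n + 1) :=
  if h : C ∈ t.clades ∧ 2 ≤ #C then t.insertBranchPoint ⟨C, h⟩ else default

/-- The weight of the edge below the vertex `C`. -/
noncomputable def edgeWeight (α γ : ℝ) (C : Finset (Fin n)) : ℝ := if #C = 1 then 1 - α else γ

/-- The weight of a branch point with `c` children. -/
noncomputable def branchWeight (α γ : ℝ) (c : ℕ) : ℝ := ((c : ℝ) - 1) * α - γ

/-- The branch points of a tree, as a set of vertices. -/
def branchPoints : Finset (Finset (Fin n)) := {C ∈ t.clades | 2 ≤ #C}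

/-- The weighted sum of a function of trees over all insertions of the last leaf, with edges and
branch points indexed by the vertices of the tree (see `insertSum_eq`). -/
noncomputable def insertSum (α γ : ℝ) (F : LeafTree (n + 1) → ℝ) : ℝ :=
  ∑ C ∈ t.clades, edgeWeight α γ C * F (t.edgeTree C) +
    ∑ C ∈ t.branchPoints, branchWeight α γ #(t.children C) * F (t.branchTree C)

lemma insertSum_eq (α γ : ℝ) (F : LeafTree (n + 1) → ℝ) :
    t.insertSum α γ F = ∑ x : t.InsertablePart, t.weight α γ x * F (t.insertLeaf x) := by
  rw [Fintype.sum_sum_type, insertSum]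
  congr 1
  · rw [sum_subtype t.clades (p := fun C => C ∈ t.clades) (fun _ => Iff.rfl)]
    refine sum_congr rfl fun C _ => ?_
    simp only [edgeTree, dif_pos C.2, weight, edgeWeight, insertLeaf]
  · rw [sum_subtype t.branchPoints (p := fun C => C ∈ t.clades ∧ 2 ≤ #C)
      (fun _ => by simp [branchPoints])]
    refine sum_congr rfl fun C _ => ?_
    simp only [branchTree, dif_pos C.2, weight, branchWeight, insertLeaf]

variable {t}

lemma sum_growthMatrix_mul {α γ : ℝ} (hn : 2 ≤ n) (F : LeafTree (n + 1) → ℝ) :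
    ∑ s, growthMatrix α γ n t s * F s = t.insertSum α γ F / (n - α) := by
  simp only [growthMatrix, if_neg (show ¬ n ≤ 1 by omega), insertSum_eq, sum_mul, ite_mul, zero_mul]
  rw [sum_comm]
  simp only [sum_ite_eq, mem_univ, if_true]
  rw [sum_div]
  exact sum_congr rfl fun x _ => by ring

lemma card_branchPoints : #t.branchPoints + n = #t.clades := by
  rw [← card_filter_add_card_filter_not (s := t.clades) (fun C => #C = 1),
    card_singleton_clades, add_comm]
  congr 2
  ext C
  simp only [branchPoints, mem_filter]
  refine and_congr_right fun hC => ?_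
  have := (nonempty_of_mem hC).card_pos
  omega

/-- The total weight of the insertable parts of a tree with `n` leaves is `n - α`. -/
lemma insertSum_one (α γ : ℝ) (hn : 1 ≤ n) : t.insertSum α γ (fun _ => 1) = n - α := by
  have h1 : ∑ C ∈ t.branchPoints, #(t.children C) + 1 = #t.clades := by
    rw [← sum_card_children hn]
    congr 1
    refine sum_subset (filter_subset _ _) fun C hC hC' => ?_
    have : ¬ 2 ≤ #C := fun h => hC' (mem_filter.2 ⟨hC, h⟩)
    rw [t.children_eq_empty (by omega), card_empty]
  have h2 := card_branchPoints (t := t)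
  have h3 : #{C ∈ t.clades | ¬ #C = 1} = #t.branchPoints := by
    have := card_filter_add_card_filter_not (s := t.clades) (fun C => #C = 1)
    rw [card_singleton_clades] at this
    omega
  simp only [insertSum, edgeWeight, branchWeight, mul_one, sum_sub_distrib, ← sum_mul, sum_const,
    sum_ite, card_singleton_clades, h3, nsmul_eq_mul]
  have h1' : (∑ C ∈ t.branchPoints, (#(t.children C) : ℝ)) + 1 = #t.clades := by exact_mod_cast h1
  have h2' : (#t.branchPoints : ℝ) + n = #t.clades := by exact_mod_cast h2
  linear_combination α * (h1' - h2')

lemma insertSum_nonneg {α γ : ℝ} (hγ : 0 ≤ γ) (hγα : γ ≤ α) (hα : α ≤ 1)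
    {F : LeafTree (n + 1) → ℝ} (hF : ∀ s, 0 ≤ F s) : 0 ≤ t.insertSum α γ F := by
  refine add_nonneg (sum_nonneg fun C _ => mul_nonneg ?_ (hF _))
    (sum_nonneg fun C hC => mul_nonneg ?_ (hF _))
  · rw [edgeWeight]
    split_ifs
    · linarith
    · exact hγ
  · have h2 : (2 : ℝ) ≤ #(t.children C) := by
      exact_mod_cast t.two_le_card_children (mem_filter.1 hC).2
    rw [branchWeight]
    nlinarith

/-- With at most two leaves there is only one tree. -/
lemma subsingleton_of_le_two (hn : n ≤ 2) : Subsingleton (LeafTree n) := by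
  have key : ∀ t : LeafTree n, ∀ C : Finset (Fin n),
      C ∈ t.clades ↔ C.Nonempty := by
    refine fun t C => ⟨nonempty_of_mem, fun hC => ?_⟩
    have hpos : 0 < n := hC.choose.pos
    have hle : #C ≤ n := by simpa using card_le_univ C
    rcases (show #C = 1 ∨ #C = n by have := hC.card_pos; omega) with h | h
    · obtain ⟨i, rfl⟩ := card_eq_one.1 h
      exact t.singleton_mem i
    · rw [card_eq_iff_eq_univ C |>.1 (by simpa using h)]
      exact t.univ_mem hpos
  exact ⟨fun s t => LeafTree.ext (by ext C; rw [key s, key t])⟩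

/-- The growth step is stochastic. -/
lemma isStochastic_growthMatrix {α γ : ℝ} (hγ : 0 ≤ γ) (hγα : γ ≤ α) (hα : α ≤ 1) (n : ℕ) :
    IsStochastic (growthMatrix α γ n) := by
  rcases Nat.lt_or_ge 1 n with hn | hn
  · have hpos : (0 : ℝ) < n - α := by
      have : (2 : ℝ) ≤ n := by exact_mod_cast hn
      linarith
    constructor
    · intro t s
      have h := sum_growthMatrix_mul (α := α) (γ := γ) (t := t) hn
        (fun s' => if s = s' then 1 else 0)
      simp only [mul_ite, mul_one, mul_zero, sum_ite_eq, mem_univ, if_true] at h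
      rw [h]
      exact div_nonneg (insertSum_nonneg hγ hγα hα fun s' => by split_ifs <;> norm_num) hpos.le
    · intro t
      have h := sum_growthMatrix_mul (α := α) (γ := γ) (t := t) hn (fun _ => 1)
      simp only [mul_one] at h
      rw [h, insertSum_one α γ (by omega), div_self hpos.ne']
  · have := subsingleton_of_le_two (n := n + 1) (by omega)
    refine ⟨fun t s => by simp [growthMatrix, hn], fun t => ?_⟩
    simp only [growthMatrix, if_pos hn, sum_const, card_univ, nsmul_eq_mul, mul_one]
    rw [Fintype.card_eq_one_iff.2 ⟨default, fun x => Subsingleton.elim _ _⟩, Nat.cast_one]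

end Growth

/-! ### Vertices of a tree with an inserted leaf -/

section Insert

variable {m : ℕ} {t : LeafTree m} {C D : Finset (Fin m)} {i : Fin m}

/-- The vertex `C` with the last leaf added. -/
def liftLast (C : Finset (Fin m)) : Finset (Fin (m + 1)) := insert (Fin.last m) (lift C)

@[simp] lemma castSucc_mem_lift {a : Fin m} : a.castSucc ∈ lift C ↔ a ∈ C := by
  simp [lift]

@[simp] lemma castSucc_mem_liftLast {a : Fin m} : a.castSucc ∈ liftLast C ↔ a ∈ C := by
  simp [liftLast, Fin.castSucc_ne_last]

@[simp] lemma last_mem_liftLast : Fin.last m ∈ liftLast C := by simp [liftLast]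

lemma lift_singleton (i : Fin m) : lift {i} = {i.castSucc} := by simp [lift]

lemma liftLast_subset : liftLast C ⊆ liftLast D ↔ C ⊆ D := by
  refine ⟨fun h a ha => castSucc_mem_liftLast.1 (h (castSucc_mem_liftLast.2 ha)), fun h => ?_⟩
  exact insert_subset_insert _ (lift_subset.2 h)

lemma lift_subset_liftLast : lift C ⊆ liftLast D ↔ C ⊆ D := by
  refine ⟨fun h a ha => castSucc_mem_liftLast.1 (h (castSucc_mem_lift.2 ha)), fun h => ?_⟩
  exact (lift_subset.2 h).trans (subset_insert _ _)

lemma not_liftLast_subset_lift : ¬ liftLast C ⊆ lift D :=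
  fun h => last_notMem_lift D (h last_mem_liftLast)

lemma lift_ssubset_liftLast : lift C ⊂ liftLast C := ssubset_insert (last_notMem_lift C)

lemma erase_last_liftLast : (liftLast C).erase (Fin.last m) = lift C :=
  erase_insert (last_notMem_lift C)

lemma lift_ssubset : lift C ⊂ lift D ↔ C ⊂ D := by
  simp only [ssubset_iff_subset_not_subset, lift_subset]

lemma mem_edgeTree (hC : C ∈ t.clades) {X : Finset (Fin (m + 1))} :
    X ∈ (t.edgeTree C).clades ↔ (∃ D ∈ t.clades, ¬ C ⊂ D ∧ lift D = X) ∨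
      (∃ D ∈ t.clades, C ⊆ D ∧ liftLast D = X) ∨ X = {Fin.last m} := by
  rw [edgeTree, dif_pos hC]
  simp only [insertEdge, mem_attach, mem_filter, and_assoc, liftLast]

lemma mem_branchTree (hC : C ∈ t.branchPoints) {X : Finset (Fin (m + 1))} :
    X ∈ (t.branchTree C).clades ↔ (∃ D ∈ t.clades, ¬ C ⊆ D ∧ lift D = X) ∨
      (∃ D ∈ t.clades, C ⊆ D ∧ liftLast D = X) ∨ X = {Fin.last m} := by
  rw [branchTree, dif_pos (mem_filter.1 hC)]
  simp only [insertBranchPoint, mem_attach, mem_filter, and_assoc, liftLast]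

lemma singleton_last_ssubset_liftLast (hC : C.Nonempty) : {Fin.last m} ⊂ liftLast C := by
  obtain ⟨a, ha⟩ := hC
  refine (ssubset_iff_of_subset (singleton_subset_iff.2 last_mem_liftLast)).2
    ⟨a.castSucc, castSucc_mem_liftLast.2 ha, fun h => ?_⟩
  exact Fin.castSucc_ne_last a (mem_singleton.1 h)

/-- The parent of the inserted leaf is the vertex that splits the edge. -/
lemma parent_last_edgeTree (hC : C ∈ t.clades) :
    (t.edgeTree C).parent {Fin.last m} = liftLast C := by
  refine parent_eq ((mem_edgeTree hC).2 (Or.inr (Or.inl ⟨C, hC, subset_rfl, rfl⟩)))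
    (singleton_last_ssubset_liftLast (nonempty_of_mem hC)) ?_ (singleton_mem _ _)
  intro E hE hlE
  rcases (mem_edgeTree hC).1 hE with ⟨D, -, -, rfl⟩ | ⟨D, -, hCD, rfl⟩ | rfl
  · exact absurd (hlE.subset (mem_singleton_self _)) (last_notMem_lift D)
  · exact liftLast_subset.2 hCD
  · exact absurd subset_rfl hlE.not_subset

lemma parent_last_branchTree (hC : C ∈ t.branchPoints) :
    (t.branchTree C).parent {Fin.last m} = liftLast C := by
  have hC1 := (mem_filter.1 hC).1
  refine parent_eq ((mem_branchTree hC).2 (Or.inr (Or.inl ⟨C, hC1, subset_rfl, rfl⟩)))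
    (singleton_last_ssubset_liftLast (nonempty_of_mem hC1)) ?_ (singleton_mem _ _)
  intro E hE hlE
  rcases (mem_branchTree hC).1 hE with ⟨D, -, -, rfl⟩ | ⟨D, -, hCD, rfl⟩ | rfl
  · exact absurd (hlE.subset (mem_singleton_self _)) (last_notMem_lift D)
  · exact liftLast_subset.2 hCD
  · exact absurd subset_rfl hlE.not_subset

lemma lift_mem_edgeTree (hC : C ∈ t.clades) : lift C ∈ (t.edgeTree C).clades :=
  (mem_edgeTree hC).2 (Or.inl ⟨C, hC, fun h => h.not_subset subset_rfl, rfl⟩)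

lemma liftLast_mem_edgeTree (hC : C ∈ t.clades) : liftLast C ∈ (t.edgeTree C).clades :=
  (mem_edgeTree hC).2 (Or.inr (Or.inl ⟨C, hC, subset_rfl, rfl⟩))

/-- The vertex that splits the edge is the one that disappears with the inserted leaf. -/
lemma mem_survivors_edgeTree (hm : 1 ≤ m) (hC : C ∈ t.clades) {X : Finset (Fin (m + 1))} :
    X ∈ (t.edgeTree C).survivors (Fin.last m) ↔
      X ∈ (t.edgeTree C).clades ∧ X ≠ {Fin.last m} ∧ X ≠ liftLast C := by
  constructor
  · intro h
    have h' := mem_survivors.1 h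
    refine ⟨h'.1, h'.2.1, ?_⟩
    rintro rfl
    exact h'.2.2 last_mem_liftLast (erase_last_liftLast ▸ lift_mem_edgeTree hC)
  · rintro ⟨h1, h2, h3⟩
    exact mem_survivors_of_ne_parent (by omega) h1 h2 (by rwa [parent_last_edgeTree hC])

lemma mem_survivors_branchTree (hm : 1 ≤ m) (hC : C ∈ t.branchPoints)
    {X : Finset (Fin (m + 1))} :
    X ∈ (t.branchTree C).survivors (Fin.last m) ↔
      X ∈ (t.branchTree C).clades ∧ X ≠ {Fin.last m} := by
  refine ⟨fun h => ⟨(mem_survivors.1 h).1, (mem_survivors.1 h).2.1⟩, fun ⟨h1, h2⟩ => ?_⟩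
  refine mem_survivors.2 ⟨h1, h2, fun hl h3 => ?_⟩
  have h4 := (eq_parent_of_erase_mem (by omega) h1 hl h3).1
  rw [parent_last_branchTree hC] at h4
  rw [h4, erase_last_liftLast, mem_branchTree hC] at h3
  rcases h3 with ⟨D, -, hCD, h⟩ | ⟨D, -, -, h⟩ | h
  · exact hCD (lift_subset.1 h.symm.subset)
  · exact not_liftLast_subset_lift h.subset
  · exact last_notMem_lift C (h ▸ mem_singleton_self _)

/-! ### Restriction of a tree with an inserted leaf -/

lemma castSuccEmb_range (x : Fin (m + 1)) : x ≠ Fin.last m ↔ ∃ a, Fin.castSuccEmb a = x := by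
  simp only [Fin.coe_castSuccEmb]
  exact Fin.exists_castSucc_eq.symm

@[simp] lemma pre_castSucc_lift : pre Fin.castSuccEmb (lift C) = C := by ext; simp

@[simp] lemma pre_castSucc_liftLast : pre Fin.castSuccEmb (liftLast C) = C := by ext; simp

lemma pre_castSucc_singleton (i : Fin m) : pre Fin.castSuccEmb {i.castSucc} = {i} := by
  ext; simp

lemma comap_castSucc_edgeTree (hC : C ∈ t.clades) :
    (t.edgeTree C).comap Fin.castSuccEmb = t := by
  ext X : 2
  rw [mem_comap]
  constructor
  · rintro ⟨hX, Y, hY, rfl⟩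
    rcases (mem_edgeTree hC).1 hY with ⟨D, hD, -, rfl⟩ | ⟨D, hD, -, rfl⟩ | rfl
    · simpa using hD
    · simpa using hD
    · rw [pre_singleton castSuccEmb_range] at hX
      exact absurd hX not_nonempty_empty
  · intro hX
    refine ⟨nonempty_of_mem hX, ?_⟩
    by_cases h : C ⊂ X
    · exact ⟨liftLast X, (mem_edgeTree hC).2 (Or.inr (Or.inl ⟨X, hX, h.subset, rfl⟩)), by simp⟩
    · exact ⟨lift X, (mem_edgeTree hC).2 (Or.inl ⟨X, hX, h, rfl⟩), by simp⟩

lemma comap_castSucc_branchTree (hC : C ∈ t.branchPoints) :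
    (t.branchTree C).comap Fin.castSuccEmb = t := by
  ext X : 2
  rw [mem_comap]
  constructor
  · rintro ⟨hX, Y, hY, rfl⟩
    rcases (mem_branchTree hC).1 hY with ⟨D, hD, -, rfl⟩ | ⟨D, hD, -, rfl⟩ | rfl
    · simpa using hD
    · simpa using hD
    · rw [pre_singleton castSuccEmb_range] at hX
      exact absurd hX not_nonempty_empty
  · intro hX
    refine ⟨nonempty_of_mem hX, ?_⟩
    by_cases h : C ⊆ X
    · exact ⟨liftLast X, (mem_branchTree hC).2 (Or.inr (Or.inl ⟨X, hX, h, rfl⟩)), by simp⟩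
    · exact ⟨lift X, (mem_branchTree hC).2 (Or.inl ⟨X, hX, h, rfl⟩), by simp⟩

/-- The relabelling `f`, extended by fixing the last leaf. -/
def extendLast {p m : ℕ} (f : Fin p ↪ Fin m) : Fin (p + 1) ↪ Fin (m + 1) where
  toFun := Fin.lastCases (Fin.last m) fun a => (f a).castSucc
  inj' := by
    intro a b h
    induction a using Fin.lastCases with
    | last =>
      induction b using Fin.lastCases with
      | last => rfl
      | cast b =>
        simp only [Fin.lastCases_last, Fin.lastCases_castSucc] at h
        exact absurd h.symm (Fin.castSucc_ne_last _)
    | cast a =>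
      induction b using Fin.lastCases with
      | last =>
        simp only [Fin.lastCases_last, Fin.lastCases_castSucc] at h
        exact absurd h (Fin.castSucc_ne_last _)
      | cast b =>
        simp only [Fin.lastCases_castSucc, Fin.castSucc_inj] at h
        rw [f.injective h]

@[simp] lemma extendLast_last {p m : ℕ} (f : Fin p ↪ Fin m) :
    extendLast f (Fin.last p) = Fin.last m := by
  change Fin.lastCases (motive := fun _ => Fin (m + 1)) _ _ (Fin.last p) = _
  rw [Fin.lastCases_last]

@[simp] lemma extendLast_castSucc {p m : ℕ} (f : Fin p ↪ Fin m) (a : Fin p) :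
    extendLast f a.castSucc = (f a).castSucc := by
  change Fin.lastCases (motive := fun _ => Fin (m + 1)) _ _ a.castSucc = _
  rw [Fin.lastCases_castSucc]

lemma swapDelete_castSucc {p : ℕ} (i k : Fin (p + 1)) :
    swapDelete i.castSucc k.castSucc = extendLast (swapDelete i k) := by
  ext a : 1
  induction a using Fin.lastCases with
  | last =>
    rw [extendLast_last, swapDelete_apply,
      Fin.succAbove_ne_last_last (Fin.castSucc_ne_last _)]
    exact Equiv.swap_apply_of_ne_of_ne (Fin.castSucc_ne_last _).symm (Fin.castSucc_ne_last _).symm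
  | cast a =>
    rw [extendLast_castSucc, swapDelete_apply, swapDelete_apply, Fin.castSucc_succAbove_castSucc,
      ← (Fin.castSucc_injective _).swap_apply]

lemma swapDelete_last_apply (i : Fin m) (a : Fin m) :
    swapDelete i.castSucc (Fin.last m) a = if a = i then Fin.last m else a.castSucc := by
  rw [swapDelete_apply, Fin.succAbove_last]
  split_ifs with h
  · rw [h, Equiv.swap_apply_left]
  · exact Equiv.swap_apply_of_ne_of_ne (fun h' => h (Fin.castSucc_injective _ h'))
      (Fin.castSucc_ne_last _)

lemma swapDelete_last_last : swapDelete (Fin.last m) (Fin.last m) = Fin.castSuccEmb := by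
  ext a : 1
  rw [swapDelete_apply, Equiv.swap_self, Fin.succAbove_last]
  rfl

variable {p : ℕ} {f : Fin p ↪ Fin m}

lemma pre_extendLast_lift : pre (extendLast f) (lift C) = lift (pre f C) := by
  ext a
  induction a using Fin.lastCases <;> simp [last_notMem_lift]

lemma pre_extendLast_liftLast : pre (extendLast f) (liftLast C) = liftLast (pre f C) := by
  ext a
  induction a using Fin.lastCases <;> simp

lemma pre_extendLast_singleton_last :
    pre (extendLast f) {Fin.last m} = {Fin.last p} := by
  ext a
  induction a using Fin.lastCases <;> simp [Fin.castSucc_ne_last]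

lemma pre_swapDelete_last_lift : pre (swapDelete i.castSucc (Fin.last m)) (lift C) = C.erase i := by
  ext a
  rw [mem_pre, swapDelete_last_apply]
  split_ifs with h
  · simp [h, last_notMem_lift]
  · simp [h]

lemma pre_swapDelete_last_liftLast :
    pre (swapDelete i.castSucc (Fin.last m)) (liftLast C) = insert i C := by
  ext a
  rw [mem_pre, swapDelete_last_apply]
  split_ifs with h
  · simp [h]
  · simp [h]

lemma pre_swapDelete_last_singleton :
    pre (swapDelete i.castSucc (Fin.last m)) {Fin.last m} = {i} := by
  ext a
  rw [mem_pre, swapDelete_last_apply]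
  split_ifs with h
  · simp [h]
  · simp [h, Fin.castSucc_ne_last]

lemma lift_nonempty : (lift C).Nonempty ↔ C.Nonempty := Finset.map_nonempty

/-- Insertion of the last leaf into a surviving edge commutes with the removal of leaf `i`. -/
lemma comap_edgeTree (hf : ∀ x, x ≠ i ↔ ∃ a, f a = x) (hC : C ∈ t.survivors i) :
    (t.edgeTree C).comap (extendLast f) = (t.comap f).edgeTree (pre f C) := by
  have hC' := mem_survivors.1 hC
  have hne := pre_nonempty hf hC'.1 hC'.2.1
  have hCp := pre_mem_comap hf hC'.1 hC'.2.1
  ext X : 2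
  rw [mem_comap, mem_edgeTree hCp]
  constructor
  · rintro ⟨hX, Y, hY, rfl⟩
    rcases (mem_edgeTree hC'.1).1 hY with ⟨D, hD, hCD, rfl⟩ | ⟨D, hD, hCD, rfl⟩ | rfl
    · rw [pre_extendLast_lift] at hX ⊢
      exact Or.inl ⟨_, mem_comap.2 ⟨lift_nonempty.1 hX, D, hD, rfl⟩,
        fun h => hCD (ssubset_of_pre_ssubset hC'.1 hD hne h), rfl⟩
    · rw [pre_extendLast_liftLast]
      exact Or.inr (Or.inl ⟨_, mem_comap.2 ⟨hne.mono (pre_mono hCD), D, hD, rfl⟩,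
        pre_mono hCD, rfl⟩)
    · exact Or.inr (Or.inr pre_extendLast_singleton_last)
  · rintro (⟨E, hE, hCE, rfl⟩ | ⟨E, hE, hCE, rfl⟩ | rfl)
    · rw [comap_clades hf, mem_image] at hE
      obtain ⟨D, hD, rfl⟩ := hE
      have hD' := mem_survivors.1 hD
      refine ⟨lift_nonempty.2 (pre_nonempty hf hD'.1 hD'.2.1), lift D, ?_, pre_extendLast_lift⟩
      exact (mem_edgeTree hC'.1).2 (Or.inl ⟨D, hD'.1,
        fun h => hCE (pre_ssubset_pre hf hC'.1 hD h), rfl⟩)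
    · rw [comap_clades hf, mem_image] at hE
      obtain ⟨D, hD, rfl⟩ := hE
      have hD' := mem_survivors.1 hD
      refine ⟨⟨_, last_mem_liftLast⟩, liftLast D, ?_, pre_extendLast_liftLast⟩
      refine (mem_edgeTree hC'.1).2 (Or.inr (Or.inl ⟨D, hD'.1, ?_, rfl⟩))
      obtain ⟨a, ha⟩ := hne
      rcases subset_or_subset hC'.1 hD'.1 (mem_pre.1 ha) (mem_pre.1 (hCE ha)) with h | h
      · exact h
      · exact (survivors_injOn hf hC hD (subset_antisymm hCE (pre_mono h))).subset
    · exact ⟨singleton_nonempty _, {Fin.last m}, singleton_mem _ _, pre_extendLast_singleton_last⟩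

/-- A surviving vertex is a leaf, or a branch point, both before and after the removal of `i`. -/
lemma two_le_card_pre_iff (hf : ∀ x, x ≠ i ↔ ∃ a, f a = x) (hC : C ∈ t.survivors i) :
    (#(pre f C) = 1 ↔ #C = 1) ∧ (2 ≤ #(pre f C) ↔ 2 ≤ #C) := by
  have hC' := mem_survivors.1 hC
  have h0 := (pre_nonempty hf hC'.1 hC'.2.1).card_pos
  rw [card_pre hf] at h0 ⊢
  by_cases hi : i ∈ C
  · have h1 : #(C.erase i) ≠ 1 := fun h => by
      obtain ⟨a, ha⟩ := card_eq_one.1 h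
      exact hC'.2.2 hi (ha ▸ t.singleton_mem a)
    have := card_erase_add_one hi
    omega
  · rw [erase_eq_of_notMem hi] at h0 ⊢
    exact ⟨Iff.rfl, Iff.rfl⟩

/-- Insertion of the last leaf into a surviving branch point commutes with the removal of leaf `i`.
-/
lemma comap_branchTree (hf : ∀ x, x ≠ i ↔ ∃ a, f a = x) (hC : C ∈ t.survivors i)
    (h2 : 2 ≤ #C) :
    (t.branchTree C).comap (extendLast f) = (t.comap f).branchTree (pre f C) := by
  have hC' := mem_survivors.1 hC
  have hne := pre_nonempty hf hC'.1 hC'.2.1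
  have hCb : C ∈ t.branchPoints := mem_filter.2 ⟨hC'.1, h2⟩
  have hCp : pre f C ∈ (t.comap f).branchPoints :=
    mem_filter.2 ⟨pre_mem_comap hf hC'.1 hC'.2.1, (two_le_card_pre_iff hf hC).2.2 h2⟩
  ext X : 2
  rw [mem_comap, mem_branchTree hCp]
  constructor
  · rintro ⟨hX, Y, hY, rfl⟩
    rcases (mem_branchTree hCb).1 hY with ⟨D, hD, hCD, rfl⟩ | ⟨D, hD, hCD, rfl⟩ | rfl
    · rw [pre_extendLast_lift] at hX ⊢
      refine Or.inl ⟨_, mem_comap.2 ⟨lift_nonempty.1 hX, D, hD, rfl⟩, fun h => ?_, rfl⟩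
      obtain ⟨a, ha⟩ := hne
      rcases subset_or_subset hC'.1 hD (mem_pre.1 ha) (mem_pre.1 (h ha)) with h' | h'
      · exact hCD h'
      · exact (pre_ssubset_pre hf hD hC (h'.ssubset_of_not_subset hCD)).not_subset h
    · rw [pre_extendLast_liftLast]
      exact Or.inr (Or.inl ⟨_, mem_comap.2 ⟨hne.mono (pre_mono hCD), D, hD, rfl⟩,
        pre_mono hCD, rfl⟩)
    · exact Or.inr (Or.inr pre_extendLast_singleton_last)
  · rintro (⟨E, hE, hCE, rfl⟩ | ⟨E, hE, hCE, rfl⟩ | rfl)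
    · rw [comap_clades hf, mem_image] at hE
      obtain ⟨D, hD, rfl⟩ := hE
      have hD' := mem_survivors.1 hD
      refine ⟨lift_nonempty.2 (pre_nonempty hf hD'.1 hD'.2.1), lift D, ?_, pre_extendLast_lift⟩
      exact (mem_branchTree hCb).2 (Or.inl ⟨D, hD'.1, fun h => hCE (pre_mono h), rfl⟩)
    · rw [comap_clades hf, mem_image] at hE
      obtain ⟨D, hD, rfl⟩ := hE
      have hD' := mem_survivors.1 hD
      refine ⟨⟨_, last_mem_liftLast⟩, liftLast D, ?_, pre_extendLast_liftLast⟩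
      refine (mem_branchTree hCb).2 (Or.inr (Or.inl ⟨D, hD'.1, ?_, rfl⟩))
      obtain ⟨a, ha⟩ := hne
      rcases subset_or_subset hC'.1 hD'.1 (mem_pre.1 ha) (mem_pre.1 (hCE ha)) with h | h
      · exact h
      · exact (survivors_injOn hf hC hD (subset_antisymm hCE (pre_mono h))).subset
    · exact ⟨singleton_nonempty _, {Fin.last m}, singleton_mem _ _, pre_extendLast_singleton_last⟩

/-- The insertions into the tree with leaf `i` removed are those into the surviving parts. -/
lemma insertSum_comap (hf : ∀ x, x ≠ i ↔ ∃ a, f a = x) (α γ : ℝ) (F : LeafTree (p + 1) → ℝ) :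
    (t.comap f).insertSum α γ F =
      ∑ C ∈ t.survivors i, edgeWeight α γ C * F ((t.edgeTree C).comap (extendLast f)) +
        ∑ C ∈ t.survivors i with 2 ≤ #C, branchWeight α γ #((t.children C).erase {i}) *
          F ((t.branchTree C).comap (extendLast f)) := by
  rw [insertSum, comap_clades hf, sum_image (survivors_injOn hf)]
  congr 1
  · refine sum_congr rfl fun C hC => ?_
    rw [comap_edgeTree hf hC, edgeWeight, edgeWeight]
    simp only [(two_le_card_pre_iff hf hC).1]
  · have : (t.comap f).branchPoints = ({C ∈ t.survivors i | 2 ≤ #C}).image (pre f) := by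
      ext X
      simp only [branchPoints, mem_filter, comap_clades hf, mem_image]
      constructor
      · rintro ⟨⟨C, hC, rfl⟩, h2⟩
        exact ⟨C, ⟨hC, (two_le_card_pre_iff hf hC).2.1 h2⟩, rfl⟩
      · rintro ⟨C, ⟨hC, h2⟩, rfl⟩
        exact ⟨⟨C, hC, rfl⟩, (two_le_card_pre_iff hf hC).2.2 h2⟩
    rw [this, sum_image fun C hC D hD h =>
      survivors_injOn hf (mem_filter.1 hC).1 (mem_filter.1 hD).1 h]
    refine sum_congr rfl fun C hC => ?_
    have hC := mem_filter.1 hC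
    rw [comap_branchTree hf hC.1 hC.2, card_children_comap hf hC.1]

/-! ### Insertions that are undone by swapping with and deleting the last leaf -/

/-- Inserted into the edge of leaf `i`, the last leaf is in the old place of `i` once `i` is
removed. -/
lemma comap_edgeTree_singleton :
    (t.edgeTree {i}).comap (swapDelete i.castSucc (Fin.last m)) = t := by
  have hC := t.singleton_mem i
  ext X : 2
  rw [mem_comap]
  constructor
  · rintro ⟨hX, Y, hY, rfl⟩
    rcases (mem_edgeTree hC).1 hY with ⟨D, hD, hiD, rfl⟩ | ⟨D, hD, hiD, rfl⟩ | rfl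
    · rw [pre_swapDelete_last_lift] at hX ⊢
      by_cases hi : i ∈ D
      · have : D = {i} := by
          by_contra hne
          exact hiD ((singleton_subset_iff.2 hi).ssubset_of_ne (Ne.symm hne))
        rw [this, erase_singleton] at hX
        exact absurd hX not_nonempty_empty
      · rwa [erase_eq_of_notMem hi]
    · rw [pre_swapDelete_last_liftLast, insert_eq_of_mem (singleton_subset_iff.1 hiD)]
      exact hD
    · rw [pre_swapDelete_last_singleton]
      exact t.singleton_mem i
  · intro hX
    refine ⟨nonempty_of_mem hX, ?_⟩
    by_cases hi : i ∈ X
    · exact ⟨liftLast X, (mem_edgeTree hC).2 (Or.inr (Or.inl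
        ⟨X, hX, singleton_subset_iff.2 hi, rfl⟩)),
        by rw [pre_swapDelete_last_liftLast, insert_eq_of_mem hi]⟩
    · exact ⟨lift X, (mem_edgeTree hC).2 (Or.inl
        ⟨X, hX, fun h => hi (singleton_subset_iff.1 h.subset), rfl⟩),
        by rw [pre_swapDelete_last_lift, erase_eq_of_notMem hi]⟩

lemma parent_mem_branchPoints (hm : 2 ≤ m) (t : LeafTree m) (i : Fin m) :
    t.parent {i} ∈ t.branchPoints :=
  mem_filter.2 ⟨(parent_spec (t.singleton_mem i) (singleton_ne_univ hm i)).1,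
    two_le_card_parent hm t i⟩

/-- Inserted into the parent of leaf `i`, the last leaf is in the old place of `i` once `i` is
removed. -/
lemma comap_branchTree_parent (hm : 2 ≤ m) :
    (t.branchTree (t.parent {i})).comap (swapDelete i.castSucc (Fin.last m)) = t := by
  have hC := parent_mem_branchPoints hm t i
  have hs := parent_spec (t.singleton_mem i) (singleton_ne_univ hm i)
  have hiv : i ∈ t.parent {i} := hs.2.1.subset (mem_singleton_self i)
  ext X : 2
  rw [mem_comap]
  constructor
  · rintro ⟨hX, Y, hY, rfl⟩
    rcases (mem_branchTree hC).1 hY with ⟨D, hD, hvD, rfl⟩ | ⟨D, hD, hvD, rfl⟩ | rfl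
    · rw [pre_swapDelete_last_lift] at hX ⊢
      by_cases hi : i ∈ D
      · have : D = {i} := by
          by_contra hne
          exact hvD (hs.2.2 D hD ((singleton_subset_iff.2 hi).ssubset_of_ne (Ne.symm hne)))
        rw [this, erase_singleton] at hX
        exact absurd hX not_nonempty_empty
      · rwa [erase_eq_of_notMem hi]
    · rw [pre_swapDelete_last_liftLast, insert_eq_of_mem (hvD hiv)]
      exact hD
    · rw [pre_swapDelete_last_singleton]
      exact t.singleton_mem i
  · intro hX
    refine ⟨nonempty_of_mem hX, ?_⟩
    by_cases hi : i ∈ X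
    · by_cases hXi : X = {i}
      · exact ⟨{Fin.last m}, singleton_mem _ _, by rw [pre_swapDelete_last_singleton, hXi]⟩
      · exact ⟨liftLast X, (mem_branchTree hC).2 (Or.inr (Or.inl ⟨X, hX, hs.2.2 X hX
          ((singleton_subset_iff.2 hi).ssubset_of_ne (Ne.symm hXi)), rfl⟩)),
          by rw [pre_swapDelete_last_liftLast, insert_eq_of_mem hi]⟩
    · exact ⟨lift X, (mem_branchTree hC).2 (Or.inl ⟨X, hX, fun h => hi (h hiv), rfl⟩),
        by rw [pre_swapDelete_last_lift, erase_eq_of_notMem hi]⟩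

/-- Let the parent of leaf `i` be binary, with children `i` and `S`, and let the last leaf be
inserted into the edge above the parent.  Once `i` is removed, the last leaf is the sibling of `S`,
that is, in the old place of `i`. -/
lemma comap_edgeTree_parent (hm : 2 ≤ m) (h2 : #(t.children (t.parent {i})) ≤ 2) :
    (t.edgeTree (t.parent {i})).comap (swapDelete i.castSucc (Fin.last m)) = t := by
  have hs := parent_spec (t.singleton_mem i) (singleton_ne_univ hm i)
  have hC := hs.1
  have hiv : i ∈ t.parent {i} := hs.2.1.subset (mem_singleton_self i)
  ext X : 2
  rw [mem_comap]
  constructor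
  · rintro ⟨hX, Y, hY, rfl⟩
    rcases (mem_edgeTree hC).1 hY with ⟨D, hD, hvD, rfl⟩ | ⟨D, hD, hvD, rfl⟩ | rfl
    · rw [pre_swapDelete_last_lift] at hX ⊢
      by_cases hi : i ∈ D
      · by_cases hDi : D = {i}
        · rw [hDi, erase_singleton] at hX
          exact absurd hX not_nonempty_empty
        · have hvD' := hs.2.2 D hD ((singleton_subset_iff.2 hi).ssubset_of_ne (Ne.symm hDi))
          have : t.parent {i} = D := by
            by_contra hne
            exact hvD (hvD'.ssubset_of_ne hne)
          rw [← this]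
          exact erase_mem_of_card_children (singleton_mem_children_parent hm t i) h2
      · rwa [erase_eq_of_notMem hi]
    · rw [pre_swapDelete_last_liftLast, insert_eq_of_mem (hvD hiv)]
      exact hD
    · rw [pre_swapDelete_last_singleton]
      exact t.singleton_mem i
  · intro hX
    refine ⟨nonempty_of_mem hX, ?_⟩
    by_cases hi : i ∈ X
    · by_cases hXi : X = {i}
      · exact ⟨{Fin.last m}, singleton_mem _ _, by rw [pre_swapDelete_last_singleton, hXi]⟩
      · exact ⟨liftLast X, (mem_edgeTree hC).2 (Or.inr (Or.inl ⟨X, hX, hs.2.2 X hX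
          ((singleton_subset_iff.2 hi).ssubset_of_ne (Ne.symm hXi)), rfl⟩)),
          by rw [pre_swapDelete_last_liftLast, insert_eq_of_mem hi]⟩
    · exact ⟨lift X, (mem_edgeTree hC).2 (Or.inl ⟨X, hX, fun h => hi (h.subset hiv), rfl⟩),
        by rw [pre_swapDelete_last_lift, erase_eq_of_notMem hi]⟩

end Insert

/-! ### Deletion probabilities after an insertion -/

section DeletionInsert

variable {m : ℕ}

/-- A last leaf added to a nonempty bush does not change its least label; `minOr` also agrees on
empty bushes. -/
lemma minOr_castSucc {S : Finset (Fin (m + 1))} (h : S = ∅ ∨ (pre Fin.castSuccEmb S).Nonempty)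
    (i : Fin m) : minOr S i.castSucc = (minOr (pre Fin.castSuccEmb S) i).castSucc := by
  rcases h with rfl | h
  · have : pre Fin.castSuccEmb (∅ : Finset (Fin (m + 1))) = ∅ := by ext; simp
    simp [minOr, this]
  · have hS : S.Nonempty := ⟨_, mem_pre.1 h.choose_spec⟩
    rw [minOr, dif_pos hS, minOr, dif_pos h]
    refine le_antisymm (min'_le _ _ (mem_pre.1 (min'_mem _ h))) (le_min' _ _ _ fun l hl => ?_)
    induction l using Fin.lastCases with
    | last => exact Fin.le_last _
    | cast l => exact Fin.castSucc_le_castSucc_iff.2 (min'_le _ _ (mem_pre.2 hl))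

lemma minOr_singleton (a b : Fin m) : minOr {a} b = a := by simp [minOr]

lemma pre_sdiff {p : ℕ} (f : Fin p ↪ Fin m) (A B : Finset (Fin m)) :
    pre f (A \ B) = pre f A \ pre f B := by ext; simp

variable {T : LeafTree (m + 1)} {i : Fin m}

lemma parent_comap_castSucc (hm : 2 ≤ m)
    (hV : T.parent {i.castSucc} ∈ T.survivors (Fin.last m)) :
    (T.comap Fin.castSuccEmb).parent {i} = pre Fin.castSuccEmb (T.parent {i.castSucc}) := by
  rw [← pre_castSucc_singleton]
  refine parent_comap castSuccEmb_range (T.singleton_mem _) (fun h => ?_)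
    (singleton_ne_univ (by omega) _) hV
  exact Fin.castSucc_ne_last i (singleton_injective h)

lemma castSucc_mem_leastLabels {V : Finset (Fin (m + 1))} (hV : V ∈ T.survivors (Fin.last m))
    (k : Fin m) : k.castSucc ∈ T.leastLabels V ↔
      k ∈ (T.comap Fin.castSuccEmb).leastLabels (pre Fin.castSuccEmb V) := by
  rw [mem_leastLabels, mem_leastLabels, children_comap castSuccEmb_range hV]
  constructor
  · rintro ⟨D, hD, hkD, hmin⟩
    refine ⟨pre Fin.castSuccEmb D, mem_image.2 ⟨D, mem_erase.2 ⟨?_, hD⟩, rfl⟩, mem_pre.2 hkD, ?_⟩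
    · rintro rfl
      exact Fin.castSucc_ne_last k (mem_singleton.1 hkD)
    · exact fun l hl => Fin.castSucc_le_castSucc_iff.1 (hmin _ (mem_pre.1 hl))
  · rintro ⟨X, hX, hkX, hmin⟩
    obtain ⟨D, hD, rfl⟩ := mem_image.1 hX
    refine ⟨D, (mem_erase.1 hD).2, mem_pre.1 hkX, fun l hl => ?_⟩
    induction l using Fin.lastCases with
    | last => exact Fin.le_last _
    | cast l => exact Fin.castSucc_le_castSucc_iff.2 (hmin l (mem_pre.2 hl))

lemma last_mem_leastLabels (V : Finset (Fin (m + 1))) :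
    Fin.last m ∈ T.leastLabels V ↔ {Fin.last m} ∈ T.children V := by
  refine ⟨fun h => ?_, mem_leastLabels_of_singleton⟩
  obtain ⟨D, hD, hlD, hmin⟩ := mem_leastLabels.1 h
  have : D = {Fin.last m} :=
    eq_singleton_iff_unique_mem.2 ⟨hlD, fun l hl => le_antisymm (Fin.le_last l) (hmin l hl)⟩
  exact this ▸ hD

lemma rank_castSucc {L : Finset (Fin (m + 1))} {L' : Finset (Fin m)}
    (h : ∀ k : Fin m, k.castSucc ∈ L ↔ k ∈ L') (k : Fin m) : rank L k.castSucc = rank L' k := by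
  rw [rank, rank, ← card_map (s := {l ∈ L' | l ≤ k}) Fin.castSuccEmb]
  refine congrArg card (Finset.ext fun l => ?_)
  induction l using Fin.lastCases with
  | last => simp [(Fin.castSucc_lt_last k).not_ge, Fin.castSucc_ne_last]
  | cast l => simp [h]

/-- The deletion probabilities do not change if the inserted leaf is neither a child of the parent
of leaf `i` nor on the edge below or, at a binary vertex, above that parent. -/
lemma deletionProb_comap_castSucc (hm : 2 ≤ m) (α γ : ℝ)
    (hV : T.parent {i.castSucc} ∈ T.survivors (Fin.last m))
    (hl : {Fin.last m} ∉ T.children (T.parent {i.castSucc}))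
    (hW : #(T.children (T.parent {i.castSucc})) ≤ 2 → T.parent {i.castSucc} ≠ univ →
      T.parent (T.parent {i.castSucc}) ∈ T.survivors (Fin.last m)) :
    (∀ k : Fin m, T.deletionProb α γ i.castSucc k.castSucc =
      (T.comap Fin.castSuccEmb).deletionProb α γ i k) ∧
      T.deletionProb α γ i.castSucc (Fin.last m) = 0 := by
  have hpar := parent_comap_castSucc hm hV
  have hcard : #((T.comap Fin.castSuccEmb).children ((T.comap Fin.castSuccEmb).parent {i})) =
      #(T.children (T.parent {i.castSucc})) := by
    rw [hpar, card_children_comap castSuccEmb_range hV, erase_eq_of_notMem hl]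
  rcases Nat.lt_or_ge 2 #(T.children (T.parent {i.castSucc})) with hc | hc
  · have hL := castSucc_mem_leastLabels hV
    rw [← hpar] at hL
    refine ⟨fun k => ?_, ?_⟩
    · rw [deletionProb_of_lt α γ T _ _ hc, deletionProb_of_lt α γ _ i k (hcard ▸ hc), hcard,
        rank_castSucc hL, rank_castSucc hL]
      simp only [hL]
    · rw [deletionProb_of_lt α γ T _ _ hc, if_neg (fun h => hl ((last_mem_leastLabels _).1 h))]
  · have hVc := (mem_survivors.1 hV).1
    have h1 : minOr (T.firstBush i.castSucc) i.castSucc =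
        (minOr ((T.comap Fin.castSuccEmb).firstBush i) i).castSucc := by
      have hpre : (T.comap Fin.castSuccEmb).firstBush i =
          pre Fin.castSuccEmb (T.firstBush i.castSucc) := by
        rw [firstBush, firstBush, hpar, pre_sdiff, pre_castSucc_singleton]
      rw [hpre]
      refine minOr_castSucc (Or.inr ?_) i
      rw [← hpre, firstBush]
      exact sdiff_nonempty.2 (parent_spec ((T.comap Fin.castSuccEmb).singleton_mem i)
        (singleton_ne_univ hm i)).2.1.not_subset
    have h2 : minOr (T.secondBush i.castSucc) i.castSucc =
        (minOr ((T.comap Fin.castSuccEmb).secondBush i) i).castSucc := by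
      by_cases hu : T.parent {i.castSucc} = univ
      · have hs : T.secondBush i.castSucc = ∅ := by
          rw [secondBush, hu, parent_univ, Finset.sdiff_self]
        have hu' : pre Fin.castSuccEmb (univ : Finset (Fin (m + 1))) = univ := by ext; simp
        have hs' : (T.comap Fin.castSuccEmb).secondBush i = ∅ := by
          rw [secondBush, hpar, hu, hu', parent_univ, Finset.sdiff_self]
        rw [hs, hs']
        simp [minOr]
      · have hW' := hW hc hu
        have hspec := parent_spec hVc hu
        have hpre : (T.comap Fin.castSuccEmb).secondBush i =
            pre Fin.castSuccEmb (T.secondBush i.castSucc) := by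
          rw [secondBush, secondBush, hpar, pre_sdiff,
            parent_comap castSuccEmb_range hVc (mem_survivors.1 hV).2.1 hu hW']
        rw [hpre]
        refine minOr_castSucc (Or.inr ?_) i
        rw [secondBush, pre_sdiff]
        exact sdiff_nonempty.2
          (pre_ssubset_pre castSuccEmb_range hVc hW' hspec.2.1).not_subset
    have hmax : max i.castSucc (max (minOr (T.firstBush i.castSucc) i.castSucc)
        (minOr (T.secondBush i.castSucc) i.castSucc)) =
        (max i (max (minOr ((T.comap Fin.castSuccEmb).firstBush i) i)
          (minOr ((T.comap Fin.castSuccEmb).secondBush i) i))).castSucc := by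
      rw [h1, h2, ← Fin.strictMono_castSucc.monotone.map_max,
        ← Fin.strictMono_castSucc.monotone.map_max]
    refine ⟨fun k => ?_, ?_⟩
    · rw [deletionProb_of_le α γ T _ _ hc, deletionProb_of_le α γ _ i k (hcard ▸ hc), hmax]
      simp only [Fin.castSucc_inj]
    · rw [deletionProb_of_le α γ T _ _ hc, hmax, if_neg (Fin.castSucc_ne_last _).symm]

variable {t : LeafTree m} {C : Finset (Fin m)} {α γ : ℝ}

/-- Edges other than that of leaf `i` and, if the parent of `i` is binary, that above the parent. -/
lemma deletionProb_edgeTree (hm : 2 ≤ m) (α γ : ℝ) (hC : C ∈ t.clades) (hCi : C ≠ {i})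
    (hCv : #(t.children (t.parent {i})) ≤ 2 → C ≠ t.parent {i}) :
    (∀ k : Fin m, (t.edgeTree C).deletionProb α γ i.castSucc k.castSucc =
      t.deletionProb α γ i k) ∧ (t.edgeTree C).deletionProb α γ i.castSucc (Fin.last m) = 0 := by
  have hs := parent_spec ((t.edgeTree C).singleton_mem i.castSucc)
    (singleton_ne_univ (by omega) i.castSucc)
  have hlC := lift_mem_edgeTree hC
  have hV : (t.edgeTree C).parent {i.castSucc} ∈ (t.edgeTree C).survivors (Fin.last m) := by
    refine (mem_survivors_edgeTree (by omega) hC).2 ⟨hs.1, fun h => ?_, fun h => ?_⟩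
    · have := h ▸ hs.2.1.subset (mem_singleton_self _)
      exact Fin.castSucc_ne_last i (mem_singleton.1 this)
    · have hi := h ▸ hs.2.1.subset (mem_singleton_self _)
      have hi' : i ∈ C := castSucc_mem_liftLast.1 hi
      have hss : {i.castSucc} ⊂ lift C := by
        rw [← lift_singleton]
        exact lift_ssubset.2 ((singleton_subset_iff.2 hi').ssubset_of_ne (Ne.symm hCi))
      exact not_liftLast_subset_lift (h ▸ hs.2.2 _ hlC hss)
  have hl : {Fin.last m} ∉ (t.edgeTree C).children ((t.edgeTree C).parent {i.castSucc}) := by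
    intro h
    have h' := ((mem_children_iff (singleton_mem _ _) hs.1).1 h).2
    rw [parent_last_edgeTree hC] at h'
    exact ((mem_survivors_edgeTree (by omega) hC).1 hV).2.2 h'.symm
  have hpar := parent_comap_castSucc hm hV
  have hcard := card_children_comap castSuccEmb_range hV
  rw [← hpar, comap_castSucc_edgeTree hC, erase_eq_of_notMem hl] at hcard
  rw [comap_castSucc_edgeTree hC] at hpar
  have key := deletionProb_comap_castSucc hm α γ hV hl ?_
  · rwa [comap_castSucc_edgeTree hC] at key
  intro hc hu
  have hs2 := parent_spec hs.1 hu
  refine (mem_survivors_edgeTree (by omega) hC).2 ⟨hs2.1, fun h => ?_, fun h => ?_⟩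
  · rw [h] at hs2
    exact (nonempty_of_mem hs.1).ne_empty (ssubset_singleton_iff.1 hs2.2.1)
  · have hlast : Fin.last m ∉ (t.edgeTree C).parent {i.castSucc} := by
      intro hlast
      have hle := (parent_spec ((t.edgeTree C).singleton_mem (Fin.last m))
        (singleton_ne_univ (by omega) _)).2.2 _ hs.1
        ((singleton_subset_iff.2 hlast).ssubset_of_ne ((mem_survivors.1 hV).2.1).symm)
      rw [parent_last_edgeTree hC, ← h] at hle
      exact hs2.2.1.not_subset hle
    have hVC : (t.edgeTree C).parent {i.castSucc} ⊆ lift C := by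
      rw [← erase_last_liftLast, ← h]
      exact fun x hx => mem_erase.2 ⟨fun hx' => hlast (hx' ▸ hx), hs2.2.1.subset hx⟩
    have hVC' : (t.edgeTree C).parent {i.castSucc} = lift C := by
      by_contra hne
      have := hs2.2.2 _ hlC (hVC.ssubset_of_ne hne)
      rw [h] at this
      exact not_liftLast_subset_lift this
    rw [hVC', pre_castSucc_lift] at hpar
    exact hCv (hcard ▸ hc) hpar.symm

lemma deletionProb_branchTree (hm : 2 ≤ m) (α γ : ℝ) (hC : C ∈ t.branchPoints)
    (hCv : C ≠ t.parent {i}) :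
    (∀ k : Fin m, (t.branchTree C).deletionProb α γ i.castSucc k.castSucc =
      t.deletionProb α γ i k) ∧
      (t.branchTree C).deletionProb α γ i.castSucc (Fin.last m) = 0 := by
  have hs := parent_spec ((t.branchTree C).singleton_mem i.castSucc)
    (singleton_ne_univ (by omega) i.castSucc)
  have hV : (t.branchTree C).parent {i.castSucc} ∈ (t.branchTree C).survivors (Fin.last m) := by
    refine (mem_survivors_branchTree (by omega) hC).2 ⟨hs.1, fun h => ?_⟩
    have := h ▸ hs.2.1.subset (mem_singleton_self _)
    exact Fin.castSucc_ne_last i (mem_singleton.1 this)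
  have hpar := parent_comap_castSucc hm hV
  rw [comap_castSucc_branchTree hC] at hpar
  have hl : {Fin.last m} ∉ (t.branchTree C).children ((t.branchTree C).parent {i.castSucc}) := by
    intro h
    have h' := ((mem_children_iff (singleton_mem _ _) hs.1).1 h).2
    rw [parent_last_branchTree hC] at h'
    rw [← h', pre_castSucc_liftLast] at hpar
    exact hCv hpar.symm
  have key := deletionProb_comap_castSucc hm α γ hV hl ?_
  · rwa [comap_castSucc_branchTree hC] at key
  intro _ hu
  have hs2 := parent_spec hs.1 hu
  refine (mem_survivors_branchTree (by omega) hC).2 ⟨hs2.1, fun h => ?_⟩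
  rw [h] at hs2
  exact (nonempty_of_mem hs.1).ne_empty (ssubset_singleton_iff.1 hs2.2.1)

lemma max_last_left (a b : Fin (m + 1)) : max a (max (Fin.last m) b) = Fin.last m := by
  rw [max_eq_left (Fin.le_last b), max_eq_right (Fin.le_last a)]

lemma max_last_right (a b : Fin (m + 1)) : max a (max b (Fin.last m)) = Fin.last m := by
  rw [max_eq_right (Fin.le_last b), max_eq_right (Fin.le_last a)]

/-- The inserted leaf is the whole first bush, and its label is the maximum. -/
lemma deletionProb_edgeTree_singleton (hm : 2 ≤ m) (α γ : ℝ) (k : Fin (m + 1)) :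
    (t.edgeTree {i}).deletionProb α γ i.castSucc k = if k = Fin.last m then 1 else 0 := by
  have hC := t.singleton_mem i
  have hll := liftLast_mem_edgeTree hC
  have hl := lift_mem_edgeTree hC
  have hss : {i.castSucc} ⊂ liftLast {i} := by
    rw [← lift_singleton]
    exact lift_ssubset_liftLast
  have hV : (t.edgeTree {i}).parent {i.castSucc} = liftLast {i} := by
    refine parent_eq hll hss (fun E hE hiE => ?_) ((t.edgeTree {i}).singleton_mem _)
    rcases (mem_edgeTree hC).1 hE with ⟨D, -, hD, rfl⟩ | ⟨D, -, hD, rfl⟩ | rfl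
    · rw [← lift_singleton, lift_ssubset] at hiE
      exact absurd hiE hD
    · exact liftLast_subset.2 hD
    · exact absurd (mem_singleton.1 (hiE.subset (mem_singleton_self _))) (Fin.castSucc_ne_last i)
  have hc : #((t.edgeTree {i}).children ((t.edgeTree {i}).parent {i.castSucc})) ≤ 2 := by
    rw [hV]
    refine (eq_parent_of_erase_mem (i := Fin.last m) (by omega) hll last_mem_liftLast ?_).2.le
    rwa [erase_last_liftLast]
  have hb : (t.edgeTree {i}).firstBush i.castSucc = {Fin.last m} := by
    rw [firstBush, hV, liftLast, lift_singleton]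
    ext x
    simp only [Finset.mem_sdiff, mem_insert, mem_singleton]
    constructor
    · tauto
    · rintro rfl
      exact ⟨Or.inl rfl, (Fin.castSucc_ne_last i).symm⟩
  rw [deletionProb_of_le α γ _ _ _ hc, hb, minOr_singleton, max_last_left]

/-- The inserted leaf is the whole second bush, and its label is the maximum. -/
lemma deletionProb_edgeTree_parent (hm : 2 ≤ m) (α γ : ℝ)
    (h2 : #(t.children (t.parent {i})) ≤ 2) (k : Fin (m + 1)) :
    (t.edgeTree (t.parent {i})).deletionProb α γ i.castSucc k =
      if k = Fin.last m then 1 else 0 := by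
  have hs := parent_spec (t.singleton_mem i) (singleton_ne_univ hm i)
  have hC := hs.1
  have hll := liftLast_mem_edgeTree hC
  have hl := lift_mem_edgeTree hC
  have hss : {i.castSucc} ⊂ lift (t.parent {i}) := by
    rw [← lift_singleton]
    exact lift_ssubset.2 hs.2.1
  have hV : (t.edgeTree (t.parent {i})).parent {i.castSucc} = lift (t.parent {i}) := by
    refine parent_eq hl hss (fun E hE hiE => ?_) (singleton_mem _ _)
    rcases (mem_edgeTree hC).1 hE with ⟨D, hDt, -, rfl⟩ | ⟨D, -, hD, rfl⟩ | rfl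
    · rw [← lift_singleton, lift_ssubset] at hiE
      exact lift_subset.2 (hs.2.2 D hDt hiE)
    · exact lift_subset_liftLast.2 hD
    · exact absurd (mem_singleton.1 (hiE.subset (mem_singleton_self _))) (Fin.castSucc_ne_last i)
  have hW : (t.edgeTree (t.parent {i})).parent (lift (t.parent {i})) =
      liftLast (t.parent {i}) := by
    refine parent_eq hll lift_ssubset_liftLast (fun E hE hiE => ?_) hl
    rcases (mem_edgeTree hC).1 hE with ⟨D, -, hD, rfl⟩ | ⟨D, -, hD, rfl⟩ | rfl
    · exact absurd (lift_ssubset.1 hiE) hD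
    · exact liftLast_subset.2 hD
    · exact absurd (ssubset_singleton_iff.1 hiE) (nonempty_of_mem hl).ne_empty
  have hsurv : lift (t.parent {i}) ∈ (t.edgeTree (t.parent {i})).survivors (Fin.last m) := by
    refine (mem_survivors_edgeTree (by omega) hC).2 ⟨hl, fun h => ?_, lift_ssubset_liftLast.ne⟩
    exact last_notMem_lift _ (h ▸ mem_singleton_self _)
  have hc : #((t.edgeTree (t.parent {i})).children
      ((t.edgeTree (t.parent {i})).parent {i.castSucc})) ≤ 2 := by
    have := card_children_comap castSuccEmb_range hsurv
    rw [comap_castSucc_edgeTree hC, pre_castSucc_lift, erase_eq_of_notMem] at this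
    · rw [hV, ← this]
      exact h2
    · intro h
      exact last_notMem_lift _ (((mem_children _).1 h).2.1.subset (mem_singleton_self _))
  have hb : (t.edgeTree (t.parent {i})).secondBush i.castSucc = {Fin.last m} := by
    rw [secondBush, hV, hW, liftLast]
    ext x
    simp only [Finset.mem_sdiff, mem_insert, mem_singleton]
    constructor
    · tauto
    · rintro rfl
      exact ⟨Or.inl rfl, last_notMem_lift _⟩
  rw [deletionProb_of_le α γ _ _ _ hc, hb, minOr_singleton, max_last_right]

/-- Inserted into the parent of leaf `i`, the last leaf becomes a further child of this parent. -/
lemma children_branchTree_parent (hm : 2 ≤ m) (t : LeafTree m) (i : Fin m) :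
    (t.branchTree (t.parent {i})).parent {i.castSucc} = liftLast (t.parent {i}) ∧
    liftLast (t.parent {i}) ∈ (t.branchTree (t.parent {i})).survivors (Fin.last m) ∧
    {Fin.last m} ∈ (t.branchTree (t.parent {i})).children (liftLast (t.parent {i})) ∧
    #((t.branchTree (t.parent {i})).children (liftLast (t.parent {i}))) =
      #(t.children (t.parent {i})) + 1 := by
  have hs := parent_spec (t.singleton_mem i) (singleton_ne_univ hm i)
  have hC := parent_mem_branchPoints hm t i
  have hll : liftLast (t.parent {i}) ∈ (t.branchTree (t.parent {i})).clades :=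
    (mem_branchTree hC).2 (Or.inr (Or.inl ⟨_, hs.1, subset_rfl, rfl⟩))
  have hss : {i.castSucc} ⊂ liftLast (t.parent {i}) := by
    rw [← lift_singleton]
    exact (lift_ssubset.2 hs.2.1).trans lift_ssubset_liftLast
  have hsurv : liftLast (t.parent {i}) ∈
      (t.branchTree (t.parent {i})).survivors (Fin.last m) := by
    refine (mem_survivors_branchTree (by omega) hC).2 ⟨hll, ?_⟩
    exact (singleton_last_ssubset_liftLast (nonempty_of_mem hs.1)).ne'
  have hlast : {Fin.last m} ∈
      (t.branchTree (t.parent {i})).children (liftLast (t.parent {i})) :=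
    (mem_children_iff (singleton_mem _ _) hll).2
      ⟨singleton_ne_univ (by omega) _, parent_last_branchTree hC⟩
  refine ⟨?_, hsurv, hlast, ?_⟩
  · refine parent_eq hll hss (fun E hE hiE => ?_) (singleton_mem _ _)
    rcases (mem_branchTree hC).1 hE with ⟨D, hDt, hD, rfl⟩ | ⟨D, -, hD, rfl⟩ | rfl
    · rw [← lift_singleton, lift_ssubset] at hiE
      exact absurd (hs.2.2 D hDt hiE) hD
    · exact liftLast_subset.2 hD
    · exact absurd (mem_singleton.1 (hiE.subset (mem_singleton_self _))) (Fin.castSucc_ne_last i)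
  · have := card_children_comap castSuccEmb_range hsurv
    rw [comap_castSucc_branchTree hC, pre_castSucc_liftLast] at this
    rw [this, card_erase_add_one hlast]

lemma deletionProb_branchTree_parent_of_le (hm : 2 ≤ m) (α γ : ℝ)
    (h2 : #(t.children (t.parent {i})) ≤ 2) (k : Fin (m + 1)) :
    (t.branchTree (t.parent {i})).deletionProb α γ i.castSucc k =
      if k = Fin.last m then 1 else 0 := by
  obtain ⟨hV, hsurv, hlast, hcard⟩ := children_branchTree_parent hm t i
  have hc2 := t.two_le_card_children (two_le_card_parent hm t i)
  have hc3 : #((t.branchTree (t.parent {i})).children (liftLast (t.parent {i}))) = 3 := by omega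
  have hL3 := (card_leastLabels (t.branchTree (t.parent {i})) (liftLast (t.parent {i}))).trans hc3
  have hlL := mem_leastLabels_of_singleton hlast
  set L := (t.branchTree (t.parent {i})).leastLabels (liftLast (t.parent {i})) with hLdef
  have hrl : rank L (Fin.last m) = 3 := by
    rw [← hL3, rank, filter_true_of_mem fun l _ => Fin.le_last l]
  have hri : rank L i.castSucc ≤ 2 := by
    have := rank_lt_rank hlL (Fin.castSucc_lt_last i)
    omega
  rw [deletionProb_of_lt α γ _ _ _ (by rw [hV]; omega), hV, hc3, ← hLdef,
    rankProb_three hri (hL3 ▸ rank_le L k)]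
  by_cases hk : k = Fin.last m
  · subst hk
    rw [if_pos hlL, if_pos hrl, if_pos rfl]
  · rw [if_neg hk]
    split_ifs with h1 h3
    · exact absurd (rank_injOn L h1 hlL (h3.trans hrl.symm)) hk
    · rfl
    · rfl

lemma deletionProb_branchTree_parent_of_lt (hm : 2 ≤ m) (hγ : 0 ≤ γ) (hγα : γ ≤ α)
    (h2 : 2 < #(t.children (t.parent {i}))) :
    (∀ k : Fin m, branchWeight α γ #(t.children (t.parent {i})) *
      (t.branchTree (t.parent {i})).deletionProb α γ i.castSucc k.castSucc =
        branchWeight α γ (#(t.children (t.parent {i})) - 1) * t.deletionProb α γ i k) ∧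
    branchWeight α γ #(t.children (t.parent {i})) *
      (t.branchTree (t.parent {i})).deletionProb α γ i.castSucc (Fin.last m) = α := by
  obtain ⟨hV, hsurv, hlast, hcard⟩ := children_branchTree_parent hm t i
  have hlL := mem_leastLabels_of_singleton hlast
  have hL := castSucc_mem_leastLabels hsurv
  rw [comap_castSucc_branchTree (parent_mem_branchPoints hm t i), pre_castSucc_liftLast] at hL
  have hcL := card_leastLabels t (t.parent {i})
  have hrl : rank ((t.branchTree (t.parent {i})).leastLabels (liftLast (t.parent {i})))
      (Fin.last m) = #(t.children (t.parent {i})) + 1 := by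
    rw [← hcard, ← card_leastLabels, rank, filter_true_of_mem fun l _ => Fin.le_last l]
  have hw : branchWeight α γ (#(t.children (t.parent {i})) - 1) =
      ((#(t.children (t.parent {i})) : ℝ) - 2) * α - γ := by
    rw [branchWeight, Nat.cast_sub (by omega)]
    push_cast
    ring
  refine ⟨fun k => ?_, ?_⟩
  · rw [deletionProb_of_lt α γ _ _ _ (by rw [hV]; omega), hV, hcard,
      deletionProb_of_lt α γ t i k h2, rank_castSucc hL, rank_castSucc hL]
    simp only [hL]
    split_ifs
    · rw [hw]
      exact mul_rankProb_succ hγ hγα h2 (hcL ▸ rank_le _ _)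
    · rw [mul_zero, mul_zero]
  · rw [deletionProb_of_lt α γ _ _ _ (by rw [hV]; omega), hV, hcard, if_pos hlL, rank_castSucc hL,
      hrl]
    exact mul_rankProb_succ_last hγ hγα h2 (hcL ▸ rank_le _ _)

end DeletionInsert

/-! ### Commutation of insertion and deletion -/

section Commutation

/-- The expectation of `F` after the down-step, given that leaf `i` has been selected. -/
noncomputable def deleteSum {m : ℕ} (α γ : ℝ) (i : Fin (m + 1)) (F : LeafTree m → ℝ)
    (T : LeafTree (m + 1)) : ℝ :=
  ∑ k, T.deletionProb α γ i k * F ((T.swap i k).delete k)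

variable {p : ℕ} {α γ : ℝ} {t : LeafTree (p + 1)} {i : Fin (p + 1)}

lemma deleteSum_castSucc (F : LeafTree (p + 1) → ℝ) (T : LeafTree (p + 2)) :
    deleteSum α γ i.castSucc F T =
      ∑ k : Fin (p + 1), T.deletionProb α γ i.castSucc k.castSucc *
        F (T.comap (extendLast (swapDelete i k))) +
      T.deletionProb α γ i.castSucc (Fin.last (p + 1)) *
        F (T.comap (swapDelete i.castSucc (Fin.last (p + 1)))) := by
  rw [deleteSum, Fin.sum_univ_castSucc]
  simp only [swap_delete_eq_comap, swapDelete_castSucc]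

lemma deleteSum_of_deletes_last {F : LeafTree (p + 1) → ℝ} {T : LeafTree (p + 2)}
    (h : ∀ k, T.deletionProb α γ i.castSucc k = if k = Fin.last (p + 1) then 1 else 0)
    (hT : T.comap (swapDelete i.castSucc (Fin.last (p + 1))) = t) :
    deleteSum α γ i.castSucc F T = F t := by
  simp [deleteSum_castSucc, h, hT, Fin.castSucc_ne_last]

/-- The key identity. Fix the selected leaf `i`.  Insertions next to `i` (into its edge, its parent
or, at a binary parent, the edge above it) that are followed by deletion of the inserted leaf
restore `t` and have total weight `1`; in all other cases insertion and deletion commute. -/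
lemma insertSum_deleteSum (hp : 1 ≤ p) (hγ : 0 ≤ γ) (hγα : γ ≤ α) (F : LeafTree (p + 1) → ℝ) :
    t.insertSum α γ (deleteSum α γ i.castSucc F) =
      F t + deleteSum α γ i (fun s => s.insertSum α γ F) t := by
  set v := t.parent {i} with hv
  -- the contribution of an insertion that leaves the deletion probabilities unchanged
  let Ψ : LeafTree (p + 2) → ℝ := fun T =>
    ∑ k, t.deletionProb α γ i k * F (T.comap (extendLast (swapDelete i k)))
  have hΨ : ∀ T : LeafTree (p + 2),
      ((∀ k : Fin (p + 1), T.deletionProb α γ i.castSucc k.castSucc = t.deletionProb α γ i k) ∧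
        T.deletionProb α γ i.castSucc (Fin.last (p + 1)) = 0) →
      deleteSum α γ i.castSucc F T = Ψ T := by
    rintro T ⟨h1, h2⟩
    simp only [deleteSum_castSucc, h1, h2, zero_mul, add_zero, Ψ]
  have hRHS : deleteSum α γ i (fun s => s.insertSum α γ F) t =
      ∑ C ∈ t.survivors i, edgeWeight α γ C * Ψ (t.edgeTree C) +
        ∑ C ∈ t.survivors i with 2 ≤ #C, branchWeight α γ #((t.children C).erase {i}) *
          Ψ (t.branchTree C) := by
    simp only [deleteSum, swap_delete_eq_comap,
      fun k => insertSum_comap (t := t) (range_swapDelete i k) α γ F, mul_add, sum_add_distrib,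
      mul_sum, Ψ]
    rw [sum_comm, sum_comm (s := univ) (t := {C ∈ t.survivors i | 2 ≤ #C})]
    congr 1 <;> exact sum_congr rfl fun C _ => sum_congr rfl fun k _ => by ring
  have hm : 2 ≤ p + 1 := by omega
  have hs := parent_spec (t.singleton_mem i) (singleton_ne_univ hm i)
  rw [← hv] at hs
  have hvB : v ∈ t.branchPoints := parent_mem_branchPoints hm t i
  have hc2 : 2 ≤ #(t.children v) := t.two_le_card_children (two_le_card_parent hm t i)
  have hich : {i} ∈ t.children v := singleton_mem_children_parent hm t i
  have hEi : deleteSum α γ i.castSucc F (t.edgeTree {i}) = F t :=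
    deleteSum_of_deletes_last (deletionProb_edgeTree_singleton hm α γ) comap_edgeTree_singleton
  have hwi : edgeWeight α γ {i} = 1 - α := by simp [edgeWeight]
  have hBi : ∀ C ∈ t.branchPoints, C ≠ {i} := by
    rintro C hC rfl
    have := (mem_filter.1 hC).2
    simp at this
  -- the branch points other than the parent of `i`
  have hbr : ∀ C ∈ t.branchPoints, C ≠ v →
      branchWeight α γ #(t.children C) * deleteSum α γ i.castSucc F (t.branchTree C) =
        branchWeight α γ #((t.children C).erase {i}) * Ψ (t.branchTree C) := by
    intro C hC hCv
    rw [hΨ _ (deletionProb_branchTree hm α γ hC hCv), erase_eq_of_notMem]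
    intro h
    exact hCv ((mem_children_iff (t.singleton_mem i) (mem_filter.1 hC).1).1 h).2.symm
  rw [hRHS, insertSum, ← add_sum_erase _ _ (t.singleton_mem i), ← add_sum_erase _ _ hvB, hEi, hwi]
  have hB : ∑ C ∈ t.branchPoints.erase v,
      branchWeight α γ #(t.children C) * deleteSum α γ i.castSucc F (t.branchTree C) =
      ∑ C ∈ t.branchPoints.erase v,
        branchWeight α γ #((t.children C).erase {i}) * Ψ (t.branchTree C) :=
    sum_congr rfl fun C hC => hbr C (mem_erase.1 hC).2 (mem_erase.1 hC).1
  rw [hB]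
  rcases Nat.lt_or_ge 2 #(t.children v) with hc | hc
  · have hvS : v ∈ t.survivors i := (parent_mem_survivors_iff hm t i).2 hc
    have hS : t.survivors i = t.clades.erase {i} := by
      ext C
      rw [mem_erase]
      refine ⟨fun h => ⟨(mem_survivors.1 h).2.1, (mem_survivors.1 h).1⟩, fun ⟨h1, h2⟩ => ?_⟩
      by_cases hCv : C = v
      · rwa [hCv]
      · exact mem_survivors_of_ne_parent hm h2 h1 hCv
    have hSB : ({C ∈ t.survivors i | 2 ≤ #C} : Finset _) = t.branchPoints := by
      rw [hS]
      ext C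
      simp only [branchPoints, mem_filter, mem_erase]
      refine ⟨fun h => ⟨h.1.2, h.2⟩, fun h => ⟨⟨?_, h.1⟩, h.2⟩⟩
      exact hBi C (mem_filter.2 h)
    have hE : ∑ C ∈ t.clades.erase {i}, edgeWeight α γ C *
        deleteSum α γ i.castSucc F (t.edgeTree C) =
        ∑ C ∈ t.clades.erase {i}, edgeWeight α γ C * Ψ (t.edgeTree C) := by
      refine sum_congr rfl fun C hC => ?_
      rw [hΨ _ (deletionProb_edgeTree hm α γ (mem_erase.1 hC).2 (mem_erase.1 hC).1
        fun h => absurd h hc.not_ge)]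
    have hvw : branchWeight α γ #(t.children v) * deleteSum α γ i.castSucc F (t.branchTree v) =
        branchWeight α γ #((t.children v).erase {i}) * Ψ (t.branchTree v) + α * F t := by
      obtain ⟨h1, h2⟩ := deletionProb_branchTree_parent_of_lt (α := α) (γ := γ) hm hγ hγα hc
      rw [deleteSum_castSucc, mul_add, mul_sum, ← mul_assoc, h2, comap_branchTree_parent hm,
        card_erase_of_mem hich]
      congr 1
      simp only [Ψ, mul_sum]
      exact sum_congr rfl fun k _ => by rw [← mul_assoc, ← mul_assoc, h1]
    rw [hE, hvw, hSB, hS, ← add_sum_erase _ (fun C => branchWeight α γ #((t.children C).erase {i}) *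
      Ψ (t.branchTree C)) hvB]
    ring
  · have hceq : #(t.children v) = 2 := le_antisymm hc hc2
    have hvS : v ∉ t.survivors i := fun h =>
      ((parent_mem_survivors_iff hm t i).1 h).not_ge hc
    have hS : t.survivors i = (t.clades.erase {i}).erase v := by
      ext C
      rw [mem_erase, mem_erase]
      refine ⟨fun h => ⟨?_, (mem_survivors.1 h).2.1, (mem_survivors.1 h).1⟩,
        fun ⟨h1, h2, h3⟩ => mem_survivors_of_ne_parent hm h3 h2 h1⟩
      rintro rfl
      exact hvS h
    have hSB : ({C ∈ t.survivors i | 2 ≤ #C} : Finset _) = t.branchPoints.erase v := by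
      rw [hS]
      ext C
      simp only [branchPoints, mem_filter, mem_erase]
      refine ⟨fun h => ⟨h.1.1, h.1.2.2, h.2⟩, fun h => ⟨⟨h.1, ?_, h.2.1⟩, h.2.2⟩⟩
      exact hBi C (mem_filter.2 h.2)
    have hvE : v ∈ t.clades.erase {i} := mem_erase.2 ⟨hs.2.1.ne', hs.1⟩
    have hE : ∑ C ∈ (t.clades.erase {i}).erase v, edgeWeight α γ C *
        deleteSum α γ i.castSucc F (t.edgeTree C) =
        ∑ C ∈ (t.clades.erase {i}).erase v, edgeWeight α γ C * Ψ (t.edgeTree C) := by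
      refine sum_congr rfl fun C hC => ?_
      have hC := mem_erase.1 hC
      rw [hΨ _ (deletionProb_edgeTree hm α γ (mem_erase.1 hC.2).2 (mem_erase.1 hC.2).1
        fun _ => hC.1)]
    have hEv : deleteSum α γ i.castSucc F (t.edgeTree v) = F t :=
      deleteSum_of_deletes_last (deletionProb_edgeTree_parent hm α γ hc)
        (comap_edgeTree_parent hm hc)
    have hBv : deleteSum α γ i.castSucc F (t.branchTree v) = F t :=
      deleteSum_of_deletes_last (deletionProb_branchTree_parent_of_le hm α γ hc)
        (comap_branchTree_parent hm)
    have hwv : edgeWeight α γ v = γ := by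
      have := (mem_filter.1 hvB).2
      rw [edgeWeight, if_neg (by omega)]
    have hbv : branchWeight α γ #(t.children v) = α - γ := by
      rw [hceq, branchWeight]
      push_cast
      ring
    rw [← add_sum_erase _ _ hvE, hE, hEv, hBv, hSB, hS, hwv, hbv]
    ring

end Commutation

/-! ### Invariance and ergodicity -/

section Chain

variable {α γ : ℝ}

lemma deleteSum_last {m : ℕ} (hm : 1 ≤ m) (F : LeafTree m → ℝ) (T : LeafTree (m + 1)) :
    deleteSum α γ (Fin.last m) F T = F (T.comap Fin.castSuccEmb) := by
  simp [deleteSum, deletionProb_last hm, swap_delete_eq_comap, swapDelete_last_last]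

lemma sum_downMatrix_mul {n : ℕ} (F : LeafTree n → ℝ) (T : LeafTree (n + 1)) :
    ∑ s, downMatrix α γ n T s * F s = 1 / ((n : ℝ) + 1) * ∑ i, deleteSum α γ i F T := by
  simp only [downMatrix, sum_mul, ite_mul, zero_mul, deleteSum, mul_sum]
  rw [sum_comm]
  refine sum_congr rfl fun i _ => ?_
  rw [sum_comm]
  refine sum_congr rfl fun k _ => ?_
  rw [sum_ite_eq, if_pos (mem_univ _)]
  ring

lemma insertSum_congr {n : ℕ} {t : LeafTree n} {F G : LeafTree (n + 1) → ℝ}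
    (hE : ∀ C ∈ t.clades, F (t.edgeTree C) = G (t.edgeTree C))
    (hB : ∀ C ∈ t.branchPoints, F (t.branchTree C) = G (t.branchTree C)) :
    t.insertSum α γ F = t.insertSum α γ G := by
  rw [insertSum, insertSum]
  congr 1
  · exact sum_congr rfl fun C hC => by rw [hE C hC]
  · exact sum_congr rfl fun C hC => by rw [hB C hC]

lemma insertSum_const_mul {n : ℕ} (t : LeafTree n) (c : ℝ) (F : LeafTree (n + 1) → ℝ) :
    t.insertSum α γ (fun s => c * F s) = c * t.insertSum α γ F := by
  simp only [insertSum, mul_add, mul_sum]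
  congr 1 <;> exact sum_congr rfl fun C _ => by ring

lemma insertSum_sum {n : ℕ} {ι : Type*} (t : LeafTree n) (s : Finset ι)
    (F : ι → LeafTree (n + 1) → ℝ) :
    t.insertSum α γ (fun x => ∑ i ∈ s, F i x) = ∑ i ∈ s, t.insertSum α γ (F i) := by
  simp only [insertSum, mul_sum, sum_add_distrib]
  rw [sum_comm, sum_comm (s := t.branchPoints)]

/-- The up-down chain on trees with `n ≥ 3` leaves is a lazy version of the down-up chain. -/
lemma growthMatrix_mul_downMatrix (hγ : 0 ≤ γ) (hγα : γ ≤ α) (hα : α ≤ 1) {p : ℕ} (hp : 2 ≤ p) :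
    ∃ a b : ℝ, 0 ≤ a ∧ 0 < b ∧ a + b = 1 ∧
      growthMatrix α γ (p + 1) * downMatrix α γ (p + 1) =
        a • (1 : Matrix (LeafTree (p + 1)) (LeafTree (p + 1)) ℝ) + b • chainMatrix α γ (p + 1) := by
  have hp' : (2 : ℝ) ≤ p := by exact_mod_cast hp
  have h1 : (0 : ℝ) < p + 1 - α := by linarith
  have h2 : (0 : ℝ) < p - α := by linarith
  refine ⟨1 / ((p : ℝ) + 2) * (1 + (p + 1) / (p + 1 - α)),
    1 / ((p : ℝ) + 2) * ((p + 1) * (p - α) / (p + 1 - α)), by positivity, by positivity, ?_, ?_⟩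
  · field_simp
    ring
  ext t s
  let F : LeafTree (p + 1) → ℝ := fun x => if x = s then 1 else 0
  have hG : (growthMatrix α γ (p + 1) * downMatrix α γ (p + 1)) t s =
      1 / ((p : ℝ) + 2) * ((∑ i : Fin (p + 1), (F t + deleteSum α γ i
        (fun x => x.insertSum α γ F) t)) / (p + 1 - α) + F t) := by
    have hD : ∀ x, downMatrix α γ (p + 1) x s =
        1 / ((p : ℝ) + 2) * ∑ i, deleteSum α γ i F x := by
      intro x
      have := sum_downMatrix_mul (α := α) (γ := γ) F x
      simp only [F, mul_ite, mul_one, mul_zero, sum_ite_eq', mem_univ, if_true] at this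
      rw [this]
      push_cast
      congr 2
      ring
    rw [Matrix.mul_apply]
    simp only [hD]
    rw [sum_growthMatrix_mul (by omega), insertSum_const_mul, insertSum_sum,
      Fin.sum_univ_castSucc]
    simp only [fun i => insertSum_deleteSum (t := t) (i := i) (show 1 ≤ p by omega) hγ hγα F]
    have hlast : t.insertSum α γ (deleteSum α γ (Fin.last (p + 1)) F) = (p + 1 - α) * F t := by
      rw [insertSum_congr (G := fun _ => F t * 1), insertSum_const_mul,
        insertSum_one _ _ (by omega)]
      · push_cast
        ring
      · intro C hC
        rw [deleteSum_last (by omega), comap_castSucc_edgeTree hC, mul_one]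
      · intro C hC
        rw [deleteSum_last (by omega), comap_castSucc_branchTree hC, mul_one]
    rw [hlast]
    push_cast
    field_simp
  have hP : chainMatrix α γ (p + 1) t s = 1 / ((p : ℝ) + 1) *
      ((∑ i, deleteSum α γ i (fun x => x.insertSum α γ F) t) / (p - α)) := by
    have hGr : ∀ x, growthMatrix α γ p x s = x.insertSum α γ F * (1 / (p - α)) := by
      intro x
      have := sum_growthMatrix_mul (α := α) (γ := γ) (t := x) hp F
      simp only [F, mul_ite, mul_one, mul_zero, sum_ite_eq', mem_univ, if_true] at this
      rw [this, mul_one_div]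
    rw [chainMatrix, Matrix.mul_apply]
    simp only [hGr, ← mul_assoc]
    rw [← sum_mul, sum_downMatrix_mul]
    ring
  rw [hG, Matrix.add_apply, Matrix.smul_apply, Matrix.smul_apply, hP, sum_add_distrib, sum_const,
    card_univ, Fintype.card_fin, Matrix.one_apply]
  simp only [smul_eq_mul, nsmul_eq_mul, F]
  push_cast
  split_ifs <;> field_simp <;> ring

lemma growthLaw_mem_stdSimplex (hγ : 0 ≤ γ) (hγα : γ ≤ α) (hα : α ≤ 1) (n : ℕ) :
    growthLaw α γ n ∈ stdSimplex ℝ (LeafTree n) := by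
  induction n with
  | zero =>
    have := subsingleton_of_le_two (n := 0) (by omega)
    refine ⟨fun _ => zero_le_one, ?_⟩
    simp only [growthLaw, sum_const, card_univ, nsmul_eq_mul, mul_one]
    rw [Fintype.card_eq_one_iff.2 ⟨default, fun x => Subsingleton.elim _ _⟩, Nat.cast_one]
  | succ n ih => exact (isStochastic_growthMatrix hγ hγα hα n).vecMul_mem ih

lemma eq_of_mem_stdSimplex_of_subsingleton {S : Type*} [Fintype S] [Subsingleton S] {u v : S → ℝ}
    (hu : u ∈ stdSimplex ℝ S) (hv : v ∈ stdSimplex ℝ S) : u = v := by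
  ext s
  have h1 := hu.2
  have h2 := hv.2
  rw [Fintype.sum_subsingleton _ s] at h1 h2
  rw [h1, h2]

/-- The down-step takes the law of the `(n + 1)`-st step of the growth process to the law of the
`n`-th step. -/
lemma growthLaw_vecMul_downMatrix (hγ : 0 ≤ γ) (hγα : γ ≤ α) (hα : α ≤ 1) (n : ℕ) :
    growthLaw α γ (n + 1) ᵥ* downMatrix α γ n = growthLaw α γ n := by
  induction n with
  | zero =>
    have := subsingleton_of_le_two (n := 0) (by omega)
    exact eq_of_mem_stdSimplex_of_subsingleton
      ((isStochastic_downMatrix hγα (hγ.trans hγα) 0).vecMul_mem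
        (growthLaw_mem_stdSimplex hγ hγα hα 1)) (growthLaw_mem_stdSimplex hγ hγα hα 0)
  | succ n ih =>
    rcases Nat.lt_or_ge n 2 with hn | hn
    · have := subsingleton_of_le_two (n := n + 1) (by omega)
      exact eq_of_mem_stdSimplex_of_subsingleton
        ((isStochastic_downMatrix hγα (hγ.trans hγα) _).vecMul_mem
          (growthLaw_mem_stdSimplex hγ hγα hα _)) (growthLaw_mem_stdSimplex hγ hγα hα _)
    · obtain ⟨a, b, -, -, hab, h⟩ := growthMatrix_mul_downMatrix hγ hγα hα hn
      have hinv : growthLaw α γ (n + 1) ᵥ* chainMatrix α γ (n + 1) = growthLaw α γ (n + 1) := by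
        rw [chainMatrix, ← vecMul_vecMul, ih]
        rfl
      calc growthLaw α γ (n + 1 + 1) ᵥ* downMatrix α γ (n + 1)
          = growthLaw α γ (n + 1) ᵥ* (growthMatrix α γ (n + 1) * downMatrix α γ (n + 1)) := by
            rw [← vecMul_vecMul]
            rfl
        _ = growthLaw α γ (n + 1) := by
            rw [h, vecMul_add, vecMul_smul, vecMul_smul, vecMul_one, hinv, ← add_smul, hab,
              one_smul]

lemma growthLaw_vecMul_chainMatrix (hγ : 0 ≤ γ) (hγα : γ ≤ α) (hα : α ≤ 1) (n : ℕ) :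
    growthLaw α γ (n + 1) ᵥ* chainMatrix α γ (n + 1) = growthLaw α γ (n + 1) := by
  rw [chainMatrix, ← vecMul_vecMul, growthLaw_vecMul_downMatrix hγ hγα hα]
  rfl

lemma isStochastic_chainMatrix (hγ : 0 ≤ γ) (hγα : γ ≤ α) (hα : α ≤ 1) (n : ℕ) :
    IsStochastic (chainMatrix α γ (n + 1)) :=
  (isStochastic_downMatrix hγα (hγ.trans hγα) n).mul (isStochastic_growthMatrix hγ hγα hα n)

/-- By induction on the number of leaves: the property passes to the up-down chain, which is a lazy
version of the chain, and from there to the chain on trees with one more leaf. -/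
lemma hasPositiveColumn_chainMatrix (hγ : 0 ≤ γ) (hγα : γ ≤ α) (hα : α ≤ 1) (n : ℕ) :
    HasPositiveColumn (chainMatrix α γ (n + 1)) := by
  have hα0 := hγ.trans hγα
  induction n with
  | zero =>
    have := subsingleton_of_le_two (n := 0 + 1) (by omega)
    exact hasPositiveColumn_of_subsingleton _
  | succ n ih =>
    refine HasPositiveColumn.mul_comm_of_isStochastic (isStochastic_downMatrix hγα hα0 _)
      (isStochastic_growthMatrix hγ hγα hα _) ?_
    rcases Nat.lt_or_ge n 2 with hn | hn
    · have := subsingleton_of_le_two (n := n + 1) (by omega)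
      exact hasPositiveColumn_of_subsingleton _
    · obtain ⟨a, b, ha, hb, -, h⟩ := growthMatrix_mul_downMatrix hγ hγα hα hn
      rw [h]
      exact ih.lazy ha hb (isStochastic_chainMatrix hγ hγα hα n).1

end Chain

end LeafTree

lemma IsGrowthProcess.law_eq {α γ : ℝ} (hγ : 0 ≤ γ) (hγα : γ ≤ α) (hα : α ≤ 1) {Ω : Type*}
    [MeasurableSpace Ω] {P : Measure Ω} [IsProbabilityMeasure P] {T : ∀ n, Ω → LeafTree n}
    (h : IsGrowthProcess α γ P T) (n : ℕ) :
    (fun t => P.real {ω | T n ω = t}) = LeafTree.growthLaw α γ n := by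
  induction n with
  | zero =>
    have := LeafTree.subsingleton_of_le_two (n := 0) (by omega)
    exact LeafTree.eq_of_mem_stdSimplex_of_subsingleton
      (measureReal_fiber_mem_stdSimplex (h.measurable 0))
      (LeafTree.growthLaw_mem_stdSimplex hγ hγα hα 0)
  | succ n ih =>
    rw [LeafTree.growthLaw, ← ih]
    ext t
    exact h.measureReal_succ n t

theorem mainTheorem1 (α γ : ℝ) (hγ : 0 ≤ γ) (hγα : γ ≤ α) (hα : α ≤ 1) (n : ℕ) (hn : 1 ≤ n) :
    -- the chain is well defined: its transition matrix is stochastic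
    LeafTree.chainMatrix α γ n ∈ rowStochastic ℝ (LeafTree n) ∧
    -- the law of the `n`-th step of the growth process is the unique invariant distribution
    {ν ∈ stdSimplex ℝ (LeafTree n) | ν ᵥ* LeafTree.chainMatrix α γ n = ν} =
      {LeafTree.growthLaw α γ n} ∧
    -- convergence in distribution of the chain, for any initial law
    ∀ (Ω Ω' : Type*) [MeasurableSpace Ω] [MeasurableSpace Ω']
      (P : Measure Ω) (P' : Measure Ω') [IsProbabilityMeasure P] [IsProbabilityMeasure P']
      (X : ℕ → Ω → LeafTree n) (T : ∀ k, Ω' → LeafTree k),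
      IsAlphaGammaChain α γ n P X → IsGrowthProcess α γ P' T →
        (∀ t, P'.real {ω | T n ω = t} = LeafTree.growthLaw α γ n t) ∧
        TendstoInDistribution X atTop (T n) (fun _ => P) P' := by
  obtain ⟨n, rfl⟩ : ∃ k, n = k + 1 := ⟨n - 1, by omega⟩
  have hst := LeafTree.isStochastic_chainMatrix hγ hγα hα n
  have hpos := LeafTree.hasPositiveColumn_chainMatrix hγ hγα hα n
  have hmem := LeafTree.growthLaw_mem_stdSimplex hγ hγα hα (n + 1)
  have hinv := LeafTree.growthLaw_vecMul_chainMatrix hγ hγα hα n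
  refine ⟨hst.mem_rowStochastic, ?_, ?_⟩
  · ext ν
    constructor
    · rintro ⟨hν, hνP⟩
      exact hst.eq_of_vecMul_eq hpos hmem hinv hν hνP
    · rintro rfl
      exact ⟨hmem, hinv⟩
  · intro Ω Ω' _ _ P P' _ _ X T hX hT
    have hlaw := hT.law_eq hγ hγα hα (n + 1)
    refine ⟨fun t => congrFun hlaw t, ?_⟩
    refine tendstoInDistribution_of_tendsto_measureReal hX.measurable (hT.measurable _) fun s => ?_
    have hlim := hst.tendsto_vecMul_pow hpos hmem hinv
      (measureReal_fiber_mem_stdSimplex (P := P) (hX.measurable 0))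
    have hs := (tendsto_pi_nhds.1 hlim) s
    rw [← congrFun hlaw s] at hs
    refine hs.congr fun k => ?_
    exact (congrFun (IsMarkovChain.law_eq_vecMul_pow hX k) s).symm
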